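/- Let $f:[0,1]^2\to[0,\infty)$ be bounded and Riemann integrable, and let $B>0$. For each $N\ge 1$ let $\{X_{j,\ell}=X^{(N)}_{j,\ell}: 1\le j\le \ell\le N\}$ be independent real random variables, and let $W=W_N$ be the symmetric $N\times N$ random matrix with entries $W_N(j,\ell)=X_{j\wedge \ell,\,j\vee \ell}$. Assume that for all $N\ge1$ and all $1\le j,\ell\le N$ $$\mathbb E[W_N(j,\ell)]=0,\qquad \operatorname{Var}(W_N(j,\ell))=f\!\left(\tfrac jN,\tfrac \ell N\right),\qquad \mathbb E\,|W_N(j,\ell)|^m\le m^{Bm}\ \text{ for every integer } m\ge 1$$ (in particular $f$ is symmetric on the grid points $(j/N,\ell/N)$). Let $h_1,\dots,h_k:[0,1]\to\mathbb R$ be bounded Riemann-integrable functions, and let $e_i=e_i^{(N)}\in\mathbb R^N$ be the vector with entries $e_i(\ell)=h_i(\ell/N)/\sqrt N$, $1\le \ell\le N$. Then for every $1\le i\le k$, as $N\to\infty$, $$\frac{e_i' W_N^2 e_i-\mathbb E\left[e_i' W_N^2 e_i\right]}{\sqrt N}\ \xrightarrow{\ d\ }\ \mathcal N(0,\sigma_i^2),\qquad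 \sigma_i^2=2\int_{[0,1]^3} h_i^2(x)\,f(x,y)\,f(y,z)\,h_i^2(z)\,dx\,dy\,dz,$$ where $\mathcal N(0,0)$ denotes the point mass at $0$. -/

import Mathlib

open MeasureTheory ProbabilityTheory Filter Topology

noncomputable section

/-- The unit cube `[0,1]^n`, as a box of Mathlib's theory of box integrals. -/
def unitBox (n : ℕ) : BoxIntegral.Box (Fin n) where
  lower := fun _ => 0
  upper := fun _ => 1
  lower_lt_upper := fun _ => zero_lt_one

/-- `g` is Riemann integrable on `[0,1]^n`: its Riemann sums over tagged partitions of the cube into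
boxes (tags in the closed boxes) converge as the mesh tends to `0`. -/
def RiemannIntegrableOnCube (n : ℕ) (g : (Fin n → ℝ) → ℝ) : Prop :=
  BoxIntegral.Integrable (unitBox n) BoxIntegral.IntegrationParams.Riemann g
    BoxIntegral.BoxAdditiveMap.volume

/-- The grid point `j / N`, where the index `j : Fin N` (counted from `0`) stands for the
`(j + 1)`-st of the indices `1, …, N`. -/
def gridPoint (N : ℕ) (j : Fin N) : ℝ := ((j : ℕ) + 1 : ℝ) / (N : ℝ)

/-- The vector `e` with entries `e(ℓ) = h(ℓ / N) / √N`, `1 ≤ ℓ ≤ N`. -/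
def signalVector (N : ℕ) (h : ℝ → ℝ) : Fin N → ℝ :=
  fun l => h (gridPoint N l) / √(N : ℝ)

/-- The random symmetric matrix `W(j, ℓ) = X_{j ∧ ℓ, j ∨ ℓ}`. -/
def wignerMatrix {Ω : Type*} {N : ℕ} (X : Fin N → Fin N → Ω → ℝ) (ω : Ω) :
    Matrix (Fin N) (Fin N) ℝ :=
  Matrix.of fun j l => X (min j l) (max j l) ω

/-- The entries `X j ℓ`, `j ≤ ℓ`, are independent random variables, and the entries of the symmetric
matrix `W` built from them are centred, have variances `f (j / N) (ℓ / N)` and satisfy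
`E |W(j, ℓ)|^m ≤ m^(B m)` for all `m ≥ 1`. -/
structure IsWignerType {Ω : Type*} [MeasurableSpace Ω] (P : Measure Ω) (f : ℝ → ℝ → ℝ) (B : ℝ)
    (N : ℕ) (X : Fin N → Fin N → Ω → ℝ) : Prop where
  measurable : ∀ j l : Fin N, j ≤ l → Measurable (X j l)
  indep : iIndepFun (fun (p : {p : Fin N × Fin N // p.1 ≤ p.2}) => X p.1.1 p.1.2) P
  moment : ∀ j l : Fin N, ∀ m : ℕ, 1 ≤ m →
    Integrable (fun ω => |wignerMatrix X ω j l| ^ m) P ∧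
      ∫ ω, |wignerMatrix X ω j l| ^ m ∂P ≤ (m : ℝ) ^ (B * (m : ℝ))
  mean : ∀ j l : Fin N, ∫ ω, wignerMatrix X ω j l ∂P = 0
  variance : ∀ j l : Fin N,
    ProbabilityTheory.variance (fun ω => wignerMatrix X ω j l) P =
      f (gridPoint N j) (gridPoint N l)

/-- The quadratic form `e' W² e`. -/
def quadForm {Ω : Type*} {N : ℕ} (X : Fin N → Fin N → Ω → ℝ) (h : ℝ → ℝ) (ω : Ω) : ℝ :=
  signalVector N h ⬝ᵥ Matrix.mulVec ((wignerMatrix X ω) ^ 2) (signalVector N h)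

/-- `2 ∫_{[0,1]³} h²(x) f(x,y) f(y,z) h²(z) dx dy dz`. -/
def limitVariance (f : ℝ → ℝ → ℝ) (h : ℝ → ℝ) : ℝ :=
  2 * ∫ v in Set.Icc (0 : Fin 3 → ℝ) 1,
    h (v 0) ^ 2 * f (v 0) (v 1) * f (v 1) (v 2) * h (v 2) ^ 2

/-- A guard for the conversion to `ℝ≥0` in the statement: nothing is truncated there. -/
theorem limitVariance_nonneg (f : ℝ → ℝ → ℝ) (h : ℝ → ℝ)
    (hf : ∀ x ∈ Set.Icc (0 : ℝ) 1, ∀ y ∈ Set.Icc (0 : ℝ) 1, 0 ≤ f x y) :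
    0 ≤ limitVariance f h := by
  refine mul_nonneg zero_le_two (setIntegral_nonneg measurableSet_Icc fun v hv => ?_)
  have h1 : ∀ i, v i ∈ Set.Icc (0 : ℝ) 1 := fun i => ⟨hv.1 i, hv.2 i⟩
  exact mul_nonneg (mul_nonneg (mul_nonneg (sq_nonneg _) (hf _ (h1 0) _ (h1 1)))
    (hf _ (h1 1) _ (h1 2))) (sq_nonneg _)

end

/-!
Since `W` is symmetric, `e' W² e = |W e|²` is a quadratic form `∑ A a b X_a X_b` in the independent
entries `X_a` of `W`, which are indexed by the edges `a = {j, l}` (loops included) of the complete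
graph on `{1, …, N}`. Its matrix is a Gram matrix (`quadForm_eq`), and the entry `A a b` vanishes
unless the edges `a` and `b` have a common endpoint. After the normalization by `√N` it has size at
most `O(N ^ (-3 / 2))`.

The central limit theorem for such forms is proved by leaving out one variable at a time. If `A` has
no diagonal, then `Y = Y_e + 2 X_e D_e`, where `D_e = ∑ b, A e b X_b` and `Y_e` are independent of
`X_e`. A second-order expansion of `exp (2 i t X_e D_e)` gives
`E[X_e D_e exp (i t Y)] ≈ 2 i t s_e E[D_e² exp (i t Y)]`, with an error controlled by `E|D_e|³`
(`IsCentredFamily.norm_integral_mul_linForm_sub_le`). Summing over `e`, the characteristic function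
`φ` of `Y` satisfies `φ' t ≈ - 2 t E[Q exp (i t Y)]` for `Q = ∑ e, s_e D_e²`. The random variable
`Q` is itself a quadratic form, whose variance is at most `O(N ^ (-6))` times the number of closed
walks of length four in the line graph with loops; there are `O(N ^ 5)` of them
(`Edge.sum_sum_common_sq_le`), so `Q` concentrates around its mean `v / 2`, with `v = Var Y`. Hence
`φ' + v t φ` is small and `φ t ≈ exp (- v t ^ 2 / 2)`. The diagonal terms `A a a (X_a² - s_a)` are
negligible in mean square. `IsCentredFamily.norm_charFun_quadraticForm_sub_diag_le` is the resulting
quantitative statement.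

It remains to see that `v = v_N` converges to the limiting variance. Up to `O(1 / N)` it is a grid
sum of the integrand (`Edge.sum_gram_sq`: two distinct edges have at most one common endpoint). The
definition of Riemann integrability gives Darboux's criterion along the grids, hence convergence
almost everywhere of the values at grid points along subsequences
(`RiemannIntegrableOnCube.exists_subseq_tendsto_gridCorner`), and dominated convergence applies to
the product. Lévy's continuity theorem concludes.
-/

/-! ### Riemann integrable functions on grids -/

section RiemannSums

open BoxIntegral BoxIntegral.unitPartition

variable {n : ℕ}

theorem hasIntegralVertices_unitBox (n : ℕ) : hasIntegralVertices (unitBox n) :=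
  ⟨fun _ => 0, fun _ => 1, fun _ => by simp [unitBox], fun _ => by simp [unitBox]⟩

theorem mem_admissibleIndex_unitBox {N : ℕ} [NeZero N] {ν : Fin n → ℤ} :
    ν ∈ admissibleIndex N (unitBox n) ↔ ∀ i, 0 ≤ ν i ∧ ν i < N := by
  have hN : (0 : ℝ) < N := Nat.cast_pos.mpr N.pos_of_neZero
  rw [mem_admissibleIndex_iff, Box.le_iff_bounds]
  simp only [unitBox, box_lower, box_upper, Pi.le_def, ← forall_and]
  refine forall_congr' fun i => and_congr ?_ ?_
  · rw [le_div_iff₀ hN, zero_mul]; norm_cast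
  · rw [div_le_one hN, ← Int.add_one_le_iff]; norm_cast

/-- The upper right corner of the cell of the grid of mesh `1 / N` that contains `x`; the cells are
products of intervals closed on the right. -/
noncomputable def gridCorner (N : ℕ) (x : Fin n → ℝ) : Fin n → ℝ :=
  fun i => (⌈(N : ℝ) * x i⌉ : ℝ) / N

theorem tag_index (N : ℕ) (x : Fin n → ℝ) : tag N (index N x) = gridCorner N x := by
  ext i; simp [gridCorner]

theorem measurable_comp_index {β : Type*} [MeasurableSpace β] (N : ℕ) (F : (Fin n → ℤ) → β) :
    Measurable fun x : Fin n → ℝ => F (index N x) := by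
  refine (measurable_of_countable F).comp (measurable_pi_lambda _ fun i => ?_)
  exact (Int.measurable_ceil.comp ((measurable_pi_apply i).const_mul _)).sub_const 1

/-- Integrals over the cube of functions that are constant on the cells of a grid. -/
theorem setIntegral_comp_index (N : ℕ) [NeZero N] (F : (Fin n → ℤ) → ℝ) :
    ∫ x in (unitBox n : Set (Fin n → ℝ)), F (index N x) =
      ∑ ν ∈ admissibleIndex N (unitBox n), F ν / (N : ℝ) ^ n := by
  have hcover : (unitBox n : Set (Fin n → ℝ)) =
      ⋃ ν ∈ admissibleIndex N (unitBox n), (box N ν : Set (Fin n → ℝ)) := by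
    ext x
    simp only [Set.mem_iUnion, exists_prop]
    constructor
    · intro hx
      exact ⟨index N x, mem_admissibleIndex_of_mem_box N (hasIntegralVertices_unitBox n) hx,
        mem_box_iff_index.2 rfl⟩
    · rintro ⟨ν, hν, hx⟩
      exact mem_admissibleIndex_iff.1 hν hx
  have hconst : ∀ ν, Set.EqOn (fun x => F (index N x)) (fun _ => F ν)
      (box N ν : Set (Fin n → ℝ)) := fun ν x hx => by
    simp only [mem_box_iff_index.1 (show x ∈ box N ν from hx)]
  have hvol : ∀ ν : Fin n → ℤ, volume (box N ν : Set (Fin n → ℝ)) = 1 / (N : ENNReal) ^ n := by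
    intro ν; rw [volume_box, Fintype.card_fin]
  rw [hcover, integral_biUnion_finset _ (fun ν _ => (box N ν).measurableSet_coe)
    (fun ν _ ν' _ h => disjoint.1 h)]
  · refine Finset.sum_congr rfl fun ν _ => ?_
    rw [setIntegral_congr_fun (box N ν).measurableSet_coe (hconst ν), setIntegral_const,
      measureReal_def, hvol]
    simp [div_eq_inv_mul]
  · intro ν _
    rw [integrableOn_congr_fun (hconst ν) (box N ν).measurableSet_coe]
    refine integrableOn_const ?_
    exact ((box N ν).isBounded.measure_lt_top).ne

/-- For a Riemann integrable function, the Riemann sums over fine grids are close to the integral,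
uniformly in the choice of the tags. -/
theorem RiemannIntegrableOnCube.exists_forall_tags {g : (Fin n → ℝ) → ℝ}
    (hg : RiemannIntegrableOnCube n g) :
    ∃ y : ℝ, ∀ ε > 0, ∀ᶠ N : ℕ in atTop, ∀ t : (Fin n → ℤ) → (Fin n → ℝ),
      (∀ ν, t ν ∈ Box.Icc (box (N + 1) ν)) →
      |∑ ν ∈ admissibleIndex (N + 1) (unitBox n), g (t ν) / ((N + 1 : ℕ) : ℝ) ^ n - y| ≤ ε := by
  classical
  obtain ⟨y, hy⟩ := hg
  refine ⟨y, fun ε hε => ?_⟩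
  obtain ⟨r, hr1, hr2⟩ := hasIntegral_iff.1 hy ε hε
  have hr : ∀ x, r 0 x = r 0 0 := hr1 0 rfl
  have hev : ∀ᶠ N : ℕ in atTop, 1 / ((N + 1 : ℕ) : ℝ) < (r 0 0 : ℝ) := by
    have := (tendsto_one_div_add_atTop_nhds_zero_nat (𝕜 := ℝ)).eventually_lt_const (r 0 0).2
    simpa using this
  filter_upwards [hev] with N hN t ht
  set m : ℕ := N + 1 with hm
  -- The grid partition, with the tags replaced by `t`; the index of a cell is recovered from its
  -- upper corner.
  have htag : ∀ J ∈ (prepartition m (unitBox n)).boxes, t (index m J.upper) ∈ Box.Icc J := by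
    intro J hJ
    obtain ⟨ν, hν, rfl⟩ := mem_prepartition_boxes_iff.1 hJ
    have : index m (box m ν).upper = ν := index_tag m ν
    rw [this]
    exact ht ν
  let π : TaggedPrepartition (unitBox n) :=
    { (prepartition m (unitBox n)).toPrepartition with
      tag := fun J => if J ∈ (prepartition m (unitBox n)).boxes then t (index m J.upper)
        else (unitBox n).upper
      tag_mem_Icc := fun J => by
        split_ifs with hJ
        · exact Box.le_iff_Icc.1 ((prepartition m (unitBox n)).le_of_mem' J hJ) (htag J hJ)
        · exact Box.upper_mem_Icc _ }
  have hπtag : ∀ J ∈ π, π.tag J = t (index m J.upper) := fun J hJ => if_pos hJ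
  have hπ : IntegrationParams.Riemann.MemBaseSet (unitBox n) 0 (r 0) π := by
    refine ⟨fun J hJ x hx => ?_, fun _ J hJ => ?_, fun h => ?_, fun h => ?_⟩
    · rw [hr, Metric.mem_closedBall, hπtag J hJ]
      obtain ⟨ν, hν, rfl⟩ := mem_prepartition_boxes_iff.1 hJ
      exact (Metric.dist_le_diam_of_mem (Box.isBounded_Icc _) hx (htag _ hJ)).trans
        ((diam_boxIcc m ν).trans hN.le)
    · rw [hπtag J hJ]
      exact htag J hJ
    · exact absurd h (by decide)
    · exact absurd h (by decide)
  have hpart : π.IsPartition := prepartition_isPartition m (hasIntegralVertices_unitBox n)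
  have hdist := hr2 0 π hπ hpart
  rw [Real.dist_eq] at hdist
  convert! hdist using 3
  have hboxes : π.boxes = (admissibleIndex m (unitBox n)).image (fun ν => box m ν) := by
    ext J
    rw [Finset.mem_image]
    exact mem_prepartition_boxes_iff
  rw [integralSum, hboxes, Finset.sum_image fun ν _ ν' _ h => box_injective m h]
  refine Finset.sum_congr rfl fun ν hν => ?_
  have hmem : box m ν ∈ π := mem_prepartition_boxes_iff.2 ⟨ν, hν, rfl⟩
  have hidx : index m (box m ν).upper = ν := index_tag m ν
  rw [hπtag _ hmem, hidx, BoxAdditiveMap.volume_apply]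
  simp only [box.upper_sub_lower, Finset.prod_const, Finset.card_univ, Fintype.card_fin,
    smul_eq_mul]
  rw [div_pow, one_pow]
  ring

/-- The oscillation of `g` over the closed cell of index `ν`. It is meaningful for the cells inside
the cube, where `g` will be bounded; elsewhere the supremum and the infimum may be junk. -/
noncomputable def cellOsc (g : (Fin n → ℝ) → ℝ) (N : ℕ) [NeZero N] (ν : Fin n → ℤ) : ℝ :=
  sSup (g '' Box.Icc (box N ν)) - sInf (g '' Box.Icc (box N ν))

section CellOsc
variable {g : (Fin n → ℝ) → ℝ} {C : ℝ} {N : ℕ} [NeZero N] {ν : Fin n → ℤ}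

theorem bddAbove_image_cell (hb : ∀ x ∈ Set.Icc (0 : Fin n → ℝ) 1, |g x| ≤ C)
    (hν : ν ∈ admissibleIndex N (unitBox n)) : BddAbove (g '' Box.Icc (box N ν)) := by
  refine ⟨C, ?_⟩
  rintro _ ⟨x, hx, rfl⟩
  exact (abs_le.1 (hb x (Box.le_iff_Icc.1 (mem_admissibleIndex_iff.1 hν) hx))).2

theorem bddBelow_image_cell (hb : ∀ x ∈ Set.Icc (0 : Fin n → ℝ) 1, |g x| ≤ C)
    (hν : ν ∈ admissibleIndex N (unitBox n)) : BddBelow (g '' Box.Icc (box N ν)) := by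
  refine ⟨-C, ?_⟩
  rintro _ ⟨x, hx, rfl⟩
  exact (abs_le.1 (hb x (Box.le_iff_Icc.1 (mem_admissibleIndex_iff.1 hν) hx))).1

theorem abs_sub_le_cellOsc (hb : ∀ x ∈ Set.Icc (0 : Fin n → ℝ) 1, |g x| ≤ C)
    (hν : ν ∈ admissibleIndex N (unitBox n)) {x y : Fin n → ℝ} (hx : x ∈ Box.Icc (box N ν))
    (hy : y ∈ Box.Icc (box N ν)) : |g x - g y| ≤ cellOsc g N ν := by
  have h1 := le_csSup (bddAbove_image_cell hb hν) (Set.mem_image_of_mem g hx)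
  have h2 := le_csSup (bddAbove_image_cell hb hν) (Set.mem_image_of_mem g hy)
  have h3 := csInf_le (bddBelow_image_cell hb hν) (Set.mem_image_of_mem g hx)
  have h4 := csInf_le (bddBelow_image_cell hb hν) (Set.mem_image_of_mem g hy)
  rw [cellOsc, abs_le]
  constructor <;> linarith

theorem exists_cellOsc_lt (g : (Fin n → ℝ) → ℝ) {ε : ℝ} (hε : 0 < ε)
    (N : ℕ) [NeZero N] (ν : Fin n → ℤ) :
    ∃ p : (Fin n → ℝ) × (Fin n → ℝ), p.1 ∈ Box.Icc (box N ν) ∧ p.2 ∈ Box.Icc (box N ν) ∧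
      (ν ∈ admissibleIndex N (unitBox n) → cellOsc g N ν ≤ g p.1 - g p.2 + 2 * ε) := by
  have hne : (g '' Box.Icc (box N ν)).Nonempty := ⟨_, Set.mem_image_of_mem g (Box.upper_mem_Icc _)⟩
  by_cases hν : ν ∈ admissibleIndex N (unitBox n)
  · obtain ⟨_, ⟨x, hx, rfl⟩, hx'⟩ := exists_lt_of_lt_csSup hne
      (sub_lt_self (sSup (g '' Box.Icc (box N ν))) hε)
    obtain ⟨_, ⟨y, hy, rfl⟩, hy'⟩ := exists_lt_of_csInf_lt hne
      (lt_add_of_pos_right (sInf (g '' Box.Icc (box N ν))) hε)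
    refine ⟨(x, y), hx, hy, fun _ => ?_⟩
    simp only [cellOsc]
    linarith
  · exact ⟨((box N ν).upper, (box N ν).upper), Box.upper_mem_Icc _, Box.upper_mem_Icc _,
      fun h => absurd h hν⟩

end CellOsc

theorem volume_unitBox (n : ℕ) : volume (unitBox n : Set (Fin n → ℝ)) = 1 := by
  rw [Box.coe_eq_pi, volume_pi, Measure.pi_pi]
  simp [unitBox]

/-- Darboux's criterion along the grids: the mean oscillation over the cells tends to `0`. -/
theorem RiemannIntegrableOnCube.tendsto_setIntegral_cellOsc {g : (Fin n → ℝ) → ℝ}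
    (hg : RiemannIntegrableOnCube n g) {C : ℝ}
    (hb : ∀ x ∈ Set.Icc (0 : Fin n → ℝ) 1, |g x| ≤ C) :
    Tendsto (fun N : ℕ => ∫ x in (unitBox n : Set (Fin n → ℝ)),
      cellOsc g (N + 1) (index (N + 1) x)) atTop (𝓝 0) := by
  obtain ⟨y, hy⟩ := hg.exists_forall_tags
  rw [Metric.tendsto_nhds]
  intro ε hε
  filter_upwards [hy (ε / 8) (by positivity)] with N hN
  choose p hp1 hp2 hp3 using fun ν => exists_cellOsc_lt g (by positivity : 0 < ε / 8)
    (N + 1) ν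
  have hx := abs_le.1 (hN (fun ν => (p ν).1) hp1)
  have hy := abs_le.1 (hN (fun ν => (p ν).2) hp2)
  have hNpos : (0 : ℝ) < ((N + 1 : ℕ) : ℝ) ^ n := by positivity
  have hone : ∑ ν ∈ admissibleIndex (N + 1) (unitBox n), (1 : ℝ) / ((N + 1 : ℕ) : ℝ) ^ n = 1 := by
    rw [← setIntegral_comp_index (N + 1) (fun _ : Fin n → ℤ => (1 : ℝ)), setIntegral_const,
      measureReal_def, volume_unitBox]
    simp
  have hle : ∑ ν ∈ admissibleIndex (N + 1) (unitBox n),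
      cellOsc g (N + 1) ν / ((N + 1 : ℕ) : ℝ) ^ n ≤
      ∑ ν ∈ admissibleIndex (N + 1) (unitBox n), (g (p ν).1 / ((N + 1 : ℕ) : ℝ) ^ n
        - g (p ν).2 / ((N + 1 : ℕ) : ℝ) ^ n + 2 * (ε / 8) * (1 / ((N + 1 : ℕ) : ℝ) ^ n)) := by
    refine Finset.sum_le_sum fun ν hν => ?_
    rw [← sub_div, mul_one_div, ← add_div]
    exact div_le_div_of_nonneg_right (hp3 ν hν) hNpos.le
  rw [Finset.sum_add_distrib, Finset.sum_sub_distrib, ← Finset.mul_sum, hone] at hle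
  have hnonneg : 0 ≤ ∑ ν ∈ admissibleIndex (N + 1) (unitBox n),
      cellOsc g (N + 1) ν / ((N + 1 : ℕ) : ℝ) ^ n :=
    Finset.sum_nonneg fun ν hν => div_nonneg ((abs_nonneg _).trans
      (abs_sub_le_cellOsc hb hν (Box.upper_mem_Icc _) (Box.upper_mem_Icc _))) hNpos.le
  rw [setIntegral_comp_index, Real.dist_eq, sub_zero, abs_of_nonneg hnonneg]
  linarith

/-- Along a subsequence of any sequence of meshes, the values of a Riemann integrable function at
the grid points converge to the function almost everywhere. -/
theorem RiemannIntegrableOnCube.exists_subseq_tendsto_gridCorner {g : (Fin n → ℝ) → ℝ}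
    (hg : RiemannIntegrableOnCube n g) {C : ℝ}
    (hb : ∀ x ∈ Set.Icc (0 : Fin n → ℝ) 1, |g x| ≤ C) {ns : ℕ → ℕ} (hns : Tendsto ns atTop atTop) :
    ∃ ms : ℕ → ℕ, StrictMono ms ∧ ∀ᵐ x : Fin n → ℝ, x ∈ unitBox n →
      Tendsto (fun k => g (gridCorner (ns (ms k) + 1) x)) atTop (𝓝 (g x)) := by
  set u : ℕ → (Fin n → ℝ) → ℝ := fun N x => cellOsc g (N + 1) (index (N + 1) x) with hu
  set μ : Measure (Fin n → ℝ) := volume.restrict (unitBox n : Set (Fin n → ℝ)) with hμ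
  have hadm : ∀ N, ∀ x ∈ unitBox n, index (N + 1) x ∈ admissibleIndex (N + 1) (unitBox n) :=
    fun N x hx => mem_admissibleIndex_of_mem_box _ (hasIntegralVertices_unitBox n) hx
  have hmemx : ∀ N (x : Fin n → ℝ), x ∈ Box.Icc (box (N + 1) (index (N + 1) x)) := fun N x =>
    Box.coe_subset_Icc (mem_box_iff_index.2 rfl)
  have hmemc : ∀ N (x : Fin n → ℝ),
      gridCorner (N + 1) x ∈ Box.Icc (box (N + 1) (index (N + 1) x)) := fun N x => by
    rw [← tag_index]
    exact Box.coe_subset_Icc (tag_mem _ _)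
  have hu0 : ∀ N, ∀ x ∈ unitBox n, 0 ≤ u N x := fun N x hx => (abs_nonneg _).trans
    (abs_sub_le_cellOsc hb (hadm N x hx) (hmemx N x) (hmemx N x))
  have huC : ∀ N, ∀ x ∈ unitBox n, u N x ≤ 2 * C := by
    intro N x hx
    have hsub : Box.Icc (box (N + 1) (index (N + 1) x)) ⊆ Set.Icc (0 : Fin n → ℝ) 1 :=
      Box.le_iff_Icc.1 (mem_admissibleIndex_iff.1 (hadm N x hx))
    have hne : (g '' Box.Icc (box (N + 1) (index (N + 1) x))).Nonempty :=
      ⟨_, Set.mem_image_of_mem g (hmemx N x)⟩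
    have h1 : sSup (g '' Box.Icc (box (N + 1) (index (N + 1) x))) ≤ C := by
      refine csSup_le hne ?_
      rintro _ ⟨z, hz, rfl⟩
      exact (abs_le.1 (hb z (hsub hz))).2
    have h2 : -C ≤ sInf (g '' Box.Icc (box (N + 1) (index (N + 1) x))) := by
      refine le_csInf hne ?_
      rintro _ ⟨z, hz, rfl⟩
      exact (abs_le.1 (hb z (hsub hz))).1
    simp only [hu, cellOsc]
    linarith
  have hfin : IsFiniteMeasure μ := ⟨by rw [hμ, Measure.restrict_apply_univ, volume_unitBox]; simp⟩
  have hum : ∀ N, Measurable (u N) := fun N => measurable_comp_index (N + 1) _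
  have hmem : ∀ᵐ x ∂μ, x ∈ unitBox n := ae_restrict_mem (unitBox n).measurableSet_coe
  have hui : ∀ N, Integrable (u N) μ := fun N =>
    Integrable.of_bound (hum N).aestronglyMeasurable (2 * C) (hmem.mono fun x hx => by
      rw [Real.norm_eq_abs, abs_of_nonneg (hu0 N x hx)]
      exact huC N x hx)
  have hL1 : ∀ N, eLpNorm (u N - 0) 1 μ = ENNReal.ofReal (∫ x, u N x ∂μ) := by
    intro N
    rw [sub_zero, eLpNorm_one_eq_lintegral_enorm, ← ofReal_integral_norm_eq_lintegral_enorm (hui N)]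
    congr 1
    refine integral_congr_ae (hmem.mono fun x hx => ?_)
    simp only [Real.norm_eq_abs, abs_of_nonneg (hu0 N x hx)]
  have hlim : Tendsto (fun k => eLpNorm (u (ns k) - 0) 1 μ) atTop (𝓝 0) := by
    simp only [hL1]
    rw [← ENNReal.ofReal_zero]
    exact ENNReal.tendsto_ofReal ((hg.tendsto_setIntegral_cellOsc hb).comp hns)
  obtain ⟨ms, hms, hae⟩ := (tendstoInMeasure_of_tendsto_eLpNorm one_ne_zero
    (fun k => (hum (ns k)).aestronglyMeasurable) aestronglyMeasurable_const
    hlim).exists_seq_tendsto_ae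
  refine ⟨ms, hms, ?_⟩
  rw [hμ, ae_restrict_iff' (unitBox n).measurableSet_coe] at hae
  filter_upwards [hae] with x hx hxI
  refine tendsto_iff_norm_sub_tendsto_zero.2 (squeeze_zero (fun _ => norm_nonneg _)
    (fun k => ?_) (hx hxI))
  exact abs_sub_le_cellOsc hb (hadm _ x hxI) (hmemc _ x) (hmemx _ x)

end RiemannSums

/-! ### Grid sums of the integrand of the limiting variance -/

section GridSums

open BoxIntegral BoxIntegral.unitPartition

theorem sum_admissibleIndex_unitBox {n : ℕ} (N : ℕ) [NeZero N] (F : (Fin n → ℤ) → ℝ) :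
    ∑ ν ∈ admissibleIndex N (unitBox n), F ν =
      ∑ j : Fin n → Fin N, F (fun i => ((j i : ℕ) : ℤ)) := by
  symm
  refine Finset.sum_bij (fun j _ i => ((j i : ℕ) : ℤ)) (fun j _ => ?_) (fun j _ j' _ h => ?_)
    (fun ν hν => ?_) (fun _ _ => rfl)
  · exact mem_admissibleIndex_unitBox.2 fun i => ⟨by positivity, by exact_mod_cast (j i).2⟩
  · ext i
    exact_mod_cast congrFun h i
  · have h := mem_admissibleIndex_unitBox.1 hν
    refine ⟨fun i => ⟨(ν i).toNat, by have := h i; omega⟩, Finset.mem_univ _, ?_⟩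
    ext i
    simpa using (h i).1

theorem sum_fin_three_arrow {α : Type*} [Fintype α] (F : (Fin 3 → α) → ℝ) :
    ∑ j : Fin 3 → α, F j = ∑ a, ∑ b, ∑ c, F ![a, b, c] := by
  let e : (Fin 3 → α) ≃ α × α × α :=
    { toFun := fun v => (v 0, v 1, v 2)
      invFun := fun p => ![p.1, p.2.1, p.2.2]
      left_inv := fun v => by ext i; fin_cases i <;> rfl
      right_inv := fun _ => rfl }
  rw [← e.symm.sum_comp, Fintype.sum_prod_type]
  exact Finset.sum_congr rfl fun a _ => Fintype.sum_prod_type _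

/-- A property that holds almost everywhere still does after adding dummy variables. -/
theorem ae_comp_of_injective {m n : ℕ} {σ : Fin m → Fin n} (hσ : Function.Injective σ)
    {p : (Fin m → ℝ) → Prop} (hp : ∀ᵐ y, p y) : ∀ᵐ x : Fin n → ℝ, p (x ∘ σ) := by
  set L : (Fin n → ℝ) →ₗ[ℝ] (Fin m → ℝ) := LinearMap.funLeft ℝ ℝ σ with hL
  obtain ⟨c, -, hc⟩ := L.exists_map_addHaar_eq_smul_addHaar volume volume
    (LinearMap.funLeft_surjective_of_injective ℝ ℝ σ hσ)
  have h : ∀ᵐ y ∂(volume.map L), p y := by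
    rw [hc]
    exact Measure.ae_smul_measure hp c
  exact ae_of_ae_map L.continuous_of_finiteDimensional.aemeasurable h

/-- The integrand of the limiting variance. -/
def varianceIntegrand (f : ℝ → ℝ → ℝ) (h : ℝ → ℝ) (v : Fin 3 → ℝ) : ℝ :=
  h (v 0) ^ 2 * f (v 0) (v 1) * f (v 1) (v 2) * h (v 2) ^ 2

theorem gridCorner_mem_Icc {n N : ℕ} [NeZero N] {x : Fin n → ℝ} (hx : x ∈ unitBox n) :
    gridCorner N x ∈ Set.Icc (0 : Fin n → ℝ) 1 := by
  rw [← tag_index]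
  have hadm := mem_admissibleIndex_of_mem_box N (hasIntegralVertices_unitBox n) hx
  exact Box.coe_subset_Icc (mem_admissibleIndex_iff.1 hadm (tag_mem N (index N x)))

theorem comp_mem_unitBox {m n : ℕ} {σ : Fin m → Fin n} {x : Fin n → ℝ} (hx : x ∈ unitBox n) :
    x ∘ σ ∈ unitBox m := fun i => hx (σ i)

/-- The grid sums of the integrand of the limiting variance converge to its integral, by dominated
convergence along subsequences. -/
theorem tendsto_sum_varianceIntegrand {f : ℝ → ℝ → ℝ} {h : ℝ → ℝ} {C C' : ℝ}
    (hf : ∀ x ∈ Set.Icc (0 : ℝ) 1, ∀ y ∈ Set.Icc (0 : ℝ) 1, |f x y| ≤ C)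
    (hf_int : RiemannIntegrableOnCube 2 (fun v => f (v 0) (v 1)))
    (hh : ∀ x ∈ Set.Icc (0 : ℝ) 1, |h x| ≤ C')
    (hh_int : RiemannIntegrableOnCube 1 (fun v => h (v 0))) :
    Tendsto (fun N : ℕ => (∑ j : Fin (N + 1), ∑ l : Fin (N + 1), ∑ m : Fin (N + 1),
        h (gridPoint (N + 1) j) ^ 2 * f (gridPoint (N + 1) j) (gridPoint (N + 1) l) *
          f (gridPoint (N + 1) l) (gridPoint (N + 1) m) * h (gridPoint (N + 1) m) ^ 2) /
            ((N + 1 : ℕ) : ℝ) ^ 3) atTop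
      (𝓝 (∫ v in Set.Icc (0 : Fin 3 → ℝ) 1, varianceIntegrand f h v)) := by
  have hsum : ∀ N : ℕ, (∑ j : Fin (N + 1), ∑ l : Fin (N + 1), ∑ m : Fin (N + 1),
        h (gridPoint (N + 1) j) ^ 2 * f (gridPoint (N + 1) j) (gridPoint (N + 1) l) *
          f (gridPoint (N + 1) l) (gridPoint (N + 1) m) * h (gridPoint (N + 1) m) ^ 2) /
            ((N + 1 : ℕ) : ℝ) ^ 3 =
      ∫ x in (unitBox 3 : Set (Fin 3 → ℝ)), varianceIntegrand f h (gridCorner (N + 1) x) := by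
    intro N
    have h1 := setIntegral_comp_index (n := 3) (N + 1)
      (fun ν => varianceIntegrand f h (tag (N + 1) ν))
    simp only [tag_index] at h1
    rw [h1, sum_admissibleIndex_unitBox (N + 1)
      (fun ν => varianceIntegrand f h (tag (N + 1) ν) / ((N + 1 : ℕ) : ℝ) ^ 3),
      ← Finset.sum_div, sum_fin_three_arrow]
    rfl
  have hae : (unitBox 3 : Set (Fin 3 → ℝ)) =ᵐ[volume] Set.Icc (0 : Fin 3 → ℝ) 1 :=
    Box.coe_ae_eq_Icc (unitBox 3)
  simp only [hsum]
  rw [← setIntegral_congr_set hae]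
  refine tendsto_of_subseq_tendsto fun ns hns => ?_
  have hb2 : ∀ x ∈ Set.Icc (0 : Fin 2 → ℝ) 1, |f (x 0) (x 1)| ≤ C := fun x hx =>
    hf _ ⟨hx.1 0, hx.2 0⟩ _ ⟨hx.1 1, hx.2 1⟩
  have hb1 : ∀ x ∈ Set.Icc (0 : Fin 1 → ℝ) 1, |h (x 0)| ≤ C' := fun x hx => hh _ ⟨hx.1 0, hx.2 0⟩
  obtain ⟨ms, hms, haef⟩ := hf_int.exists_subseq_tendsto_gridCorner hb2 hns
  obtain ⟨ks, hks, haeh⟩ := hh_int.exists_subseq_tendsto_gridCorner hb1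
    (hns.comp hms.tendsto_atTop)
  refine ⟨ms ∘ ks, ?_⟩
  -- the pairs and single coordinates of `x` on which the factors of the integrand depend
  have h01 := ae_comp_of_injective (σ := ![(0 : Fin 3), 1]) (by decide) haef
  have h12 := ae_comp_of_injective (σ := ![(1 : Fin 3), 2]) (by decide) haef
  have h0 := ae_comp_of_injective (σ := ![(0 : Fin 3)]) (by decide) haeh
  have h2 := ae_comp_of_injective (σ := ![(2 : Fin 3)]) (by decide) haeh
  have hfin : volume (unitBox 3 : Set (Fin 3 → ℝ)) ≠ ⊤ := by rw [volume_unitBox]; simp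
  have hmeas : ∀ N : ℕ, Measurable fun x : Fin 3 → ℝ =>
      varianceIntegrand f h (gridCorner (N + 1) x) := by
    intro N
    have := measurable_comp_index (N + 1) (fun ν : Fin 3 → ℤ =>
      varianceIntegrand f h (tag (N + 1) ν))
    simpa only [tag_index] using this
  refine tendsto_integral_of_dominated_convergence (fun _ => C' ^ 2 * C * C * C' ^ 2)
    (fun k => (hmeas _).aestronglyMeasurable) (integrableOn_const hfin) (fun k => ?_) ?_
  · filter_upwards [ae_restrict_mem (unitBox 3).measurableSet_coe] with x hx
    have hx' := gridCorner_mem_Icc (N := ns ((ms ∘ ks) k) + 1) hx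
    have m : ∀ i, gridCorner (ns ((ms ∘ ks) k) + 1) x i ∈ Set.Icc (0 : ℝ) 1 :=
      fun i => ⟨hx'.1 i, hx'.2 i⟩
    have hC : 0 ≤ C := (abs_nonneg _).trans (hf _ (m 0) _ (m 1))
    have e0 := pow_le_pow_left₀ (abs_nonneg _) (hh _ (m 0)) 2
    have e2 := pow_le_pow_left₀ (abs_nonneg _) (hh _ (m 2)) 2
    have e01 := hf _ (m 0) _ (m 1)
    have e12 := hf _ (m 1) _ (m 2)
    rw [varianceIntegrand, Real.norm_eq_abs, abs_mul, abs_mul, abs_mul, abs_pow, abs_pow]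
    gcongr
  · rw [ae_restrict_iff' (unitBox 3).measurableSet_coe]
    filter_upwards [h01, h12, h0, h2] with x a01 a12 a0 a2 hx
    have b01 := (a01 (comp_mem_unitBox hx)).comp hks.tendsto_atTop
    have b12 := (a12 (comp_mem_unitBox hx)).comp hks.tendsto_atTop
    have b0 := a0 (comp_mem_unitBox hx)
    have b2 := a2 (comp_mem_unitBox hx)
    exact (((b0.pow 2).mul b01).mul b12).mul (b2.pow 2)

end GridSums

/-! ### Linear and quadratic forms in independent variables -/

/-- A real random variable all of whose absolute moments are finite. Such variables form an algebra,
which makes the integrability of polynomial expressions automatic. -/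
def AllMoments {Ω : Type*} [MeasurableSpace Ω] (P : Measure Ω) (Z : Ω → ℝ) : Prop :=
  ∀ n : ℕ, MemLp Z n P

namespace AllMoments

variable {Ω : Type*} [MeasurableSpace Ω] {P : Measure Ω} {Y Z : Ω → ℝ}

theorem const [IsProbabilityMeasure P] (c : ℝ) : AllMoments P (fun _ => c) :=
  fun _ => memLp_const c

theorem add (hY : AllMoments P Y) (hZ : AllMoments P Z) : AllMoments P (fun ω => Y ω + Z ω) :=
  fun n => (hY n).add (hZ n)

theorem sub (hY : AllMoments P Y) (hZ : AllMoments P Z) : AllMoments P (fun ω => Y ω - Z ω) :=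
  fun n => (hY n).sub (hZ n)

theorem mul (hY : AllMoments P Y) (hZ : AllMoments P Z) : AllMoments P (fun ω => Y ω * Z ω) := by
  intro n
  have : ENNReal.HolderTriple ((2 * n : ℕ) : ENNReal) ((2 * n : ℕ) : ENNReal) (n : ENNReal) := by
    constructor
    push_cast
    rw [ENNReal.mul_inv (by simp) (by simp), ← two_mul, ← mul_assoc,
      ENNReal.mul_inv_cancel (by simp) (by simp), one_mul]
  exact (hZ (2 * n)).mul' (hY (2 * n))

theorem const_mul [IsProbabilityMeasure P] (c : ℝ) (hY : AllMoments P Y) :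
    AllMoments P (fun ω => c * Y ω) :=
  (const c).mul hY

theorem pow [IsProbabilityMeasure P] (hY : AllMoments P Y) (k : ℕ) :
    AllMoments P (fun ω => Y ω ^ k) := by
  induction k with
  | zero => simpa using const (1 : ℝ)
  | succ k ih => simpa [pow_succ] using ih.mul hY

theorem abs (hY : AllMoments P Y) : AllMoments P (fun ω => |Y ω|) := fun n => (hY n).abs

theorem sum {ι : Type*} {Y : ι → Ω → ℝ} (S : Finset ι) (hY : ∀ a ∈ S, AllMoments P (Y a)) :
    AllMoments P (fun ω => ∑ a ∈ S, Y a ω) :=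
  fun n => memLp_finsetSum S fun a ha => hY a ha n

theorem integrable (hY : AllMoments P Y) : Integrable Y P :=
  memLp_one_iff_integrable.1 (by simpa using hY 1)

end AllMoments

section Independence

variable {Ω : Type*} [MeasurableSpace Ω] {P : Measure Ω}
  {ι : Type*} [DecidableEq ι] {X : ι → Ω → ℝ}

/-- The values of `X` at the indices in `S`, with the remaining coordinates set to `0`. Any function
of the family that only depends on the indices in `S` factors through this random vector, whose type
does not depend on `S`. -/
def masked (X : ι → Ω → ℝ) (S : Finset ι) (ω : Ω) : ι → ℝ := fun a => if a ∈ S then X a ω else 0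

theorem indepFun_masked (hind : iIndepFun X P) (hm : ∀ a, Measurable (X a)) {S : Finset ι} {e : ι}
    (he : e ∉ S) : IndepFun (X e) (masked X S) P := by
  have h := hind.indepFun_finset {e} S (by simpa using he) hm
  have m1 : Measurable (fun y : ({e} : Finset ι) → ℝ => y ⟨e, by simp⟩) := measurable_pi_apply _
  have m2 : Measurable
      (fun (y : S → ℝ) (a : ι) => if ha : a ∈ S then y ⟨a, ha⟩ else 0) := by
    refine measurable_pi_lambda _ fun a => ?_
    by_cases ha : a ∈ S
    · simpa [ha] using measurable_pi_apply _
    · simp [ha]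
  have h2 := h.comp m1 m2
  exact h2

theorem measurable_masked (hm : ∀ a, Measurable (X a)) (S : Finset ι) :
    Measurable (masked X S) := by
  refine measurable_pi_lambda _ fun a => ?_
  by_cases ha : a ∈ S
  · simpa [masked, ha] using hm a
  · simp [masked, ha]

/-- Expectations factor over a coordinate and a function of the others. -/
theorem integral_mul_masked {𝕜 : Type*} [RCLike 𝕜] (hind : iIndepFun X P)
    (hm : ∀ a, Measurable (X a)) {S : Finset ι} {e : ι}
    (he : e ∉ S) {p : ℝ → 𝕜} (hp : Measurable p) {F : (ι → ℝ) → 𝕜} (hF : Measurable F) :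
    ∫ ω, p (X e ω) * F (masked X S ω) ∂P =
      (∫ ω, p (X e ω) ∂P) * ∫ ω, F (masked X S ω) ∂P :=
  ((indepFun_masked hind hm he).comp hp hF).integral_fun_mul_eq_mul_integral
    (hp.comp (hm e)).aestronglyMeasurable
    (hF.comp (measurable_masked hm S)).aestronglyMeasurable

end Independence

/-- Independent centred random variables with finite moments of all orders, variances `s a` and
fourth moments at most `K`, where `1 ≤ K` so that `K` also bounds the moments of lower order. -/
structure IsCentredFamily {Ω : Type*} [MeasurableSpace Ω] (P : Measure Ω) {ι : Type*}
    (X : ι → Ω → ℝ) (s : ι → ℝ) (K : ℝ) : Prop where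
  indep : iIndepFun X P
  measurable : ∀ a, Measurable (X a)
  allMoments : ∀ a, AllMoments P (X a)
  mean : ∀ a, ∫ ω, X a ω ∂P = 0
  sq : ∀ a, ∫ ω, X a ω ^ 2 ∂P = s a
  fourth : ∀ a, ∫ ω, X a ω ^ 4 ∂P ≤ K
  one_le : 1 ≤ K

/-- The linear form with coefficients `c`, restricted to the indices in `S`. -/
def linForm {ι : Type*} (c : ι → ℝ) (S : Finset ι) (x : ι → ℝ) : ℝ := ∑ a ∈ S, c a * x a

/-- The quadratic form with matrix `M`, restricted to the indices in `S`. -/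
def quadraticForm {ι : Type*} (M : ι → ι → ℝ) (S : Finset ι) (x : ι → ℝ) : ℝ :=
  ∑ a ∈ S, ∑ b ∈ S, M a b * (x a * x b)

section Forms
variable {ι : Type*}

theorem measurable_linForm (c : ι → ℝ) (S : Finset ι) : Measurable (linForm c S) := by
  unfold linForm; fun_prop

theorem measurable_quadraticForm (M : ι → ι → ℝ) (S : Finset ι) :
    Measurable (quadraticForm M S) := by
  unfold quadraticForm; fun_prop

variable {Ω : Type*} [DecidableEq ι]

theorem linForm_masked (c : ι → ℝ) (S : Finset ι) (X : ι → Ω → ℝ) (ω : Ω) :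
    linForm c S (masked X S ω) = linForm c S (fun a => X a ω) :=
  Finset.sum_congr rfl fun a ha => by simp [masked, ha]

theorem quadraticForm_masked (M : ι → ι → ℝ) (S : Finset ι) (X : ι → Ω → ℝ) (ω : Ω) :
    quadraticForm M S (masked X S ω) = quadraticForm M S (fun a => X a ω) :=
  Finset.sum_congr rfl fun a ha => Finset.sum_congr rfl fun b hb => by simp [masked, ha, hb]

theorem quadraticForm_insert {M : ι → ι → ℝ} (hM : ∀ a b, M a b = M b a) {S : Finset ι} {e : ι}
    (he : e ∉ S) (x : ι → ℝ) :
    quadraticForm M (insert e S) x =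
      quadraticForm M S x + 2 * (x e * linForm (M e) S x) + M e e * x e ^ 2 := by
  have h1 : ∑ a ∈ S, M a e * (x a * x e) = x e * linForm (M e) S x := by
    rw [linForm, Finset.mul_sum]
    exact Finset.sum_congr rfl fun a _ => by rw [hM a e]; ring
  have h2 : ∑ a ∈ S, M e a * (x e * x a) = x e * linForm (M e) S x := by
    rw [linForm, Finset.mul_sum]
    exact Finset.sum_congr rfl fun a _ => by ring
  simp only [quadraticForm, Finset.sum_insert he, Finset.sum_add_distrib]
  rw [h1, h2]; ring

end Forms

namespace IsCentredFamily

theorem nonneg {Ω : Type*} [MeasurableSpace Ω] {P : Measure Ω} {ι : Type*} {X : ι → Ω → ℝ}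
    {s : ι → ℝ} {K : ℝ} (hX : IsCentredFamily P X s K) (a : ι) : 0 ≤ s a :=
  hX.sq a ▸ integral_nonneg fun _ => sq_nonneg _

variable {Ω : Type*} [MeasurableSpace Ω] {P : Measure Ω} [IsProbabilityMeasure P]
  {ι : Type*} {X : ι → Ω → ℝ} {s : ι → ℝ} {K : ℝ}

theorem allMoments_linForm (hX : IsCentredFamily P X s K) (c : ι → ℝ) (S : Finset ι) :
    AllMoments P (fun ω => linForm c S (fun a => X a ω)) :=
  AllMoments.sum S fun a _ => (hX.allMoments a).const_mul _

theorem allMoments_quadraticForm (hX : IsCentredFamily P X s K) (M : ι → ι → ℝ) (S : Finset ι) :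
    AllMoments P (fun ω => quadraticForm M S (fun a => X a ω)) :=
  AllMoments.sum S fun a _ => AllMoments.sum S fun b _ =>
    ((hX.allMoments a).mul (hX.allMoments b)).const_mul _

theorem integral_sq_sub_sq (hX : IsCentredFamily P X s K) (a : ι) :
    ∫ ω, (X a ω ^ 2 - s a) ^ 2 ∂P = ∫ ω, X a ω ^ 4 ∂P - s a ^ 2 := by
  have e : ∀ ω, (X a ω ^ 2 - s a) ^ 2 = X a ω ^ 4 - 2 * s a * X a ω ^ 2 + s a ^ 2 :=
    fun ω => by ring
  have i1 := (hX.allMoments a).pow 4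
  have i2 := ((hX.allMoments a).pow 2).const_mul (2 * s a)
  simp_rw [e]
  rw [integral_add (i1.sub i2).integrable (integrable_const _),
    integral_sub i1.integrable i2.integrable, integral_const_mul, hX.sq]
  simp only [integral_const, probReal_univ, smul_eq_mul, one_mul]
  ring

theorem sq_le (hX : IsCentredFamily P X s K) (a : ι) : s a ^ 2 ≤ K := by
  have h : 0 ≤ ∫ ω, (X a ω ^ 2 - s a) ^ 2 ∂P := integral_nonneg fun _ => sq_nonneg _
  rw [hX.integral_sq_sub_sq] at h
  linarith [hX.fourth a]

theorem integral_sq_sub_sq_le (hX : IsCentredFamily P X s K) (a : ι) :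
    ∫ ω, (X a ω ^ 2 - s a) ^ 2 ∂P ≤ K := by
  rw [hX.integral_sq_sub_sq]
  linarith [hX.fourth a, sq_nonneg (s a)]

theorem le (hX : IsCentredFamily P X s K) (a : ι) : s a ≤ K := by
  nlinarith [hX.sq_le a, hX.one_le, hX.nonneg a]

theorem mul_le (hX : IsCentredFamily P X s K) (a b : ι) : s a * s b ≤ K := by
  nlinarith [hX.sq_le a, hX.sq_le b, sq_nonneg (s a - s b)]

theorem abs_le (hX : IsCentredFamily P X s K) (a : ι) : ∫ ω, |X a ω| ∂P ≤ K := by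
  have h : ∫ ω, |X a ω| ∂P ≤ ∫ ω, (1 + X a ω ^ 2) / 2 ∂P := by
    refine integral_mono (hX.allMoments a).abs.integrable
      (((integrable_const _).add ((hX.allMoments a).pow 2).integrable).div_const _) fun ω => ?_
    have := sq_abs (X a ω)
    simp only
    nlinarith [sq_nonneg (|X a ω| - 1)]
  rw [integral_div, integral_add (integrable_const _) ((hX.allMoments a).pow 2).integrable,
    hX.sq] at h
  simp only [integral_const, probReal_univ, smul_eq_mul, mul_one] at h
  linarith [hX.le a, hX.one_le]

theorem abs_cube_le (hX : IsCentredFamily P X s K) (a : ι) : ∫ ω, |X a ω| ^ 3 ∂P ≤ K := by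
  have h : ∫ ω, |X a ω| ^ 3 ∂P ≤ ∫ ω, (X a ω ^ 2 + X a ω ^ 4) / 2 ∂P := by
    refine integral_mono ((hX.allMoments a).abs.pow 3).integrable
      ((((hX.allMoments a).pow 2).integrable.add
        ((hX.allMoments a).pow 4).integrable).div_const _) fun ω => ?_
    have h1 := sq_abs (X a ω)
    have h2 : X a ω ^ 4 = |X a ω| ^ 4 := by rw [show 4 = 2 * 2 from rfl, pow_mul, pow_mul, h1]
    simp only
    rw [h2, ← h1]
    nlinarith [mul_nonneg (sq_nonneg (|X a ω|)) (sq_nonneg (|X a ω| - 1))]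
  rw [integral_div, integral_add ((hX.allMoments a).pow 2).integrable
    ((hX.allMoments a).pow 4).integrable, hX.sq] at h
  linarith [hX.le a, hX.fourth a]

theorem integral_linForm (hX : IsCentredFamily P X s K) (c : ι → ℝ) (S : Finset ι) :
    ∫ ω, linForm c S (fun a => X a ω) ∂P = 0 := by
  unfold linForm
  rw [integral_finsetSum _ fun a _ => ((hX.allMoments a).const_mul _).integrable]
  simp [integral_const_mul, hX.mean]

variable [DecidableEq ι]

omit [IsProbabilityMeasure P] in
theorem integral_mul_linForm (hX : IsCentredFamily P X s K) {S : Finset ι} {e : ι} (he : e ∉ S)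
    {p : ℝ → ℝ} (hp : Measurable p) (c : ι → ℝ) {q : ℝ → ℝ} (hq : Measurable q) :
    ∫ ω, p (X e ω) * q (linForm c S (fun a => X a ω)) ∂P =
      (∫ ω, p (X e ω) ∂P) * ∫ ω, q (linForm c S (fun a => X a ω)) ∂P := by
  simpa only [Function.comp_apply, linForm_masked] using
    integral_mul_masked hX.indep hX.measurable he hp (hq.comp (measurable_linForm c S))

theorem integral_linForm_sq (hX : IsCentredFamily P X s K) (c : ι → ℝ) (S : Finset ι) :
    ∫ ω, linForm c S (fun a => X a ω) ^ 2 ∂P = ∑ a ∈ S, c a ^ 2 * s a := by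
  induction S using Finset.induction_on with
  | empty => simp [linForm]
  | insert e S he ih =>
    have e1 : ∀ ω, linForm c (insert e S) (fun a => X a ω) ^ 2 =
        c e ^ 2 * X e ω ^ 2 + 2 * c e * (X e ω * linForm c S (fun a => X a ω))
          + linForm c S (fun a => X a ω) ^ 2 := by
      intro ω; simp only [linForm, Finset.sum_insert he]; ring
    have i1 := (hX.allMoments e).pow 2 |>.const_mul (c e ^ 2)
    have i2 := (hX.allMoments e).mul (hX.allMoments_linForm c S) |>.const_mul (2 * c e)
    have i3 := (hX.allMoments_linForm c S).pow 2
    simp_rw [e1]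
    rw [integral_add (i1.add i2).integrable i3.integrable, integral_add i1.integrable i2.integrable,
      ih, integral_const_mul, integral_const_mul,
      hX.integral_mul_linForm he (p := fun x => x) (by fun_prop) c (q := fun x => x) (by fun_prop),
      Finset.sum_insert he, hX.sq]
    simp [hX.mean]

/-- The fourth moment of a linear form is at most a multiple of the square of `∑ c a ^ 2`, as for
Gaussian variables. -/
theorem integral_linForm_fourth_le (hX : IsCentredFamily P X s K) (c : ι → ℝ) (S : Finset ι) :
    ∫ ω, linForm c S (fun a => X a ω) ^ 4 ∂P ≤ 3 * K * (∑ a ∈ S, c a ^ 2) ^ 2 := by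
  induction S using Finset.induction_on with
  | empty => simp [linForm]
  | insert e S he ih =>
    set L : Ω → ℝ := fun ω => linForm c S (fun a => X a ω) with hL
    have e1 : ∀ ω, linForm c (insert e S) (fun a => X a ω) ^ 4 =
        c e ^ 4 * X e ω ^ 4 + 4 * c e ^ 3 * (X e ω ^ 3 * L ω) +
          6 * c e ^ 2 * (X e ω ^ 2 * L ω ^ 2) + 4 * c e * (X e ω * L ω ^ 3) + L ω ^ 4 := by
      intro ω; simp only [hL, linForm, Finset.sum_insert he]; ring
    have hLm : AllMoments P L := hX.allMoments_linForm c S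
    have i1 := (hX.allMoments e).pow 4 |>.const_mul (c e ^ 4)
    have i2 := ((hX.allMoments e).pow 3).mul hLm |>.const_mul (4 * c e ^ 3)
    have i3 := ((hX.allMoments e).pow 2).mul (hLm.pow 2) |>.const_mul (6 * c e ^ 2)
    have i4 := (hX.allMoments e).mul (hLm.pow 3) |>.const_mul (4 * c e)
    have i5 := hLm.pow 4
    simp_rw [e1]
    rw [integral_add (((i1.add i2).add i3).add i4).integrable i5.integrable,
      integral_add ((i1.add i2).add i3).integrable i4.integrable,
      integral_add (i1.add i2).integrable i3.integrable, integral_add i1.integrable i2.integrable]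
    simp only [integral_const_mul]
    have f2 : ∫ ω, X e ω ^ 3 * L ω ∂P = 0 := by
      rw [hL, hX.integral_mul_linForm he (p := fun x => x ^ 3) (by fun_prop) c
        (q := fun x => x) (by fun_prop)]
      simp [hX.integral_linForm]
    have f3 : ∫ ω, X e ω ^ 2 * L ω ^ 2 ∂P = s e * ∑ a ∈ S, c a ^ 2 * s a := by
      rw [hL, hX.integral_mul_linForm he (p := fun x => x ^ 2) (by fun_prop) c
        (q := fun x => x ^ 2) (by fun_prop), hX.sq, hX.integral_linForm_sq]
    have f4 : ∫ ω, X e ω * L ω ^ 3 ∂P = 0 := by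
      rw [hL, hX.integral_mul_linForm he (p := fun x => x) (by fun_prop) c
        (q := fun x => x ^ 3) (by fun_prop), hX.mean, zero_mul]
    rw [f2, f3, f4, Finset.sum_insert he]
    have g1 : s e * ∑ a ∈ S, c a ^ 2 * s a ≤ K * ∑ a ∈ S, c a ^ 2 := by
      rw [Finset.mul_sum, Finset.mul_sum]
      refine Finset.sum_le_sum fun a _ => ?_
      nlinarith [hX.mul_le e a, sq_nonneg (c a)]
    have g2 : c e ^ 2 * (s e * ∑ a ∈ S, c a ^ 2 * s a) ≤ c e ^ 2 * (K * ∑ a ∈ S, c a ^ 2) :=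
      mul_le_mul_of_nonneg_left g1 (sq_nonneg _)
    have g3 : c e ^ 4 * ∫ ω, X e ω ^ 4 ∂P ≤ c e ^ 4 * K :=
      mul_le_mul_of_nonneg_left (hX.fourth e) (by positivity)
    have g4 : 0 ≤ c e ^ 4 * K := mul_nonneg (by positivity) (by linarith [hX.one_le])
    nlinarith

/-- A third-moment bound for linear forms, by interpolation between the second and the fourth
moment. -/
theorem integral_abs_linForm_cube_le (hX : IsCentredFamily P X s K) (c : ι → ℝ) (S : Finset ι)
    {w : ℝ} (hw : 0 < w) (hc : ∑ a ∈ S, c a ^ 2 ≤ w ^ 2) :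
    ∫ ω, |linForm c S (fun a => X a ω)| ^ 3 ∂P ≤ 4 * K * w ^ 3 := by
  set L : Ω → ℝ := fun ω => linForm c S (fun a => X a ω) with hL
  have hLm : AllMoments P L := hX.allMoments_linForm c S
  have hK := hX.one_le
  have h : ∫ ω, |L ω| ^ 3 ∂P ≤ ∫ ω, w * L ω ^ 2 + w⁻¹ * L ω ^ 4 ∂P := by
    refine integral_mono (hLm.abs.pow 3).integrable
      (((hLm.pow 2).const_mul _).add ((hLm.pow 4).const_mul _)).integrable fun ω => ?_
    have h1 := sq_abs (L ω)
    have h2 : L ω ^ 4 = |L ω| ^ 4 := by rw [show 4 = 2 * 2 from rfl, pow_mul, pow_mul, h1]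
    simp only
    rw [h2, ← h1]
    have h3 : w * |L ω| ^ 2 + w⁻¹ * |L ω| ^ 4 - |L ω| ^ 3
        = w⁻¹ * |L ω| ^ 2 * ((|L ω| - w) ^ 2 + |L ω| * w) := by
      field_simp; ring
    have h4 : 0 ≤ w⁻¹ * |L ω| ^ 2 * ((|L ω| - w) ^ 2 + |L ω| * w) := by positivity
    linarith
  rw [integral_add ((hLm.pow 2).const_mul _).integrable ((hLm.pow 4).const_mul _).integrable,
    integral_const_mul, integral_const_mul, hX.integral_linForm_sq] at h
  have h0 : 0 ≤ ∑ a ∈ S, c a ^ 2 := Finset.sum_nonneg fun _ _ => sq_nonneg _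
  have h1 : ∑ a ∈ S, c a ^ 2 * s a ≤ K * w ^ 2 := by
    calc ∑ a ∈ S, c a ^ 2 * s a ≤ ∑ a ∈ S, c a ^ 2 * K :=
          Finset.sum_le_sum fun a _ => mul_le_mul_of_nonneg_left (hX.le a) (sq_nonneg _)
      _ = K * ∑ a ∈ S, c a ^ 2 := by rw [← Finset.sum_mul, mul_comm]
      _ ≤ K * w ^ 2 := mul_le_mul_of_nonneg_left hc (by linarith)
  have h2 : ∫ ω, L ω ^ 4 ∂P ≤ 3 * K * (w ^ 2) ^ 2 :=
    (hX.integral_linForm_fourth_le c S).trans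
      (mul_le_mul_of_nonneg_left (pow_le_pow_left₀ h0 hc 2) (by linarith))
  have h3 : w⁻¹ * ∫ ω, L ω ^ 4 ∂P ≤ w⁻¹ * (3 * K * (w ^ 2) ^ 2) :=
    mul_le_mul_of_nonneg_left h2 (by positivity)
  have h4 : w⁻¹ * (3 * K * (w ^ 2) ^ 2) = 3 * K * w ^ 3 := by field_simp
  nlinarith [mul_le_mul_of_nonneg_left h1 hw.le]

/-- The variance of a quadratic form in independent centred variables is bounded by the squared
Hilbert–Schmidt norm of its matrix. -/
theorem integral_quadraticForm_sub_sq_le (hX : IsCentredFamily P X s K) {M : ι → ι → ℝ}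
    (hM : ∀ a b, M a b = M b a) (S : Finset ι) :
    ∫ ω, (quadraticForm M S (fun a => X a ω) - ∑ a ∈ S, M a a * s a) ^ 2 ∂P ≤
      8 * K * ∑ a ∈ S, ∑ b ∈ S, M a b ^ 2 := by
  induction S using Finset.induction_on with
  | empty => simp [quadraticForm]
  | insert e S he ih =>
    set m : ℝ := ∑ a ∈ S, M a a * s a with hm
    set Q : Ω → ℝ := fun ω => quadraticForm M S (fun a => X a ω) - m with hQ
    set L : Ω → ℝ := fun ω => linForm (M e) S (fun a => X a ω) with hL
    have hLm : AllMoments P L := hX.allMoments_linForm _ S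
    have hQm : AllMoments P Q := (hX.allMoments_quadraticForm M S).sub (.const _)
    have hZm : AllMoments P (fun ω => X e ω ^ 2 - s e) := ((hX.allMoments e).pow 2).sub (.const _)
    have hK := hX.one_le
    have i1 := (hX.allMoments e).mul (hQm.mul hLm) |>.const_mul 4
    have i2 := hZm.mul hQm |>.const_mul (2 * M e e)
    have i3 := ((hX.allMoments e).pow 2).mul (hLm.pow 2) |>.const_mul 8
    have i4 := (hZm.pow 2).const_mul (2 * M e e ^ 2)
    -- The increment `2 X_e L + M e e (X_e ^ 2 - s e)` is orthogonal to `Q`; its own square is split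
    -- by `(x + y) ^ 2 ≤ 2 x ^ 2 + 2 y ^ 2`.
    have hle : ∫ ω, (quadraticForm M (insert e S) (fun a => X a ω)
          - ∑ a ∈ insert e S, M a a * s a) ^ 2 ∂P ≤
        ∫ ω, (Q ω ^ 2 + 4 * (X e ω * (Q ω * L ω)) + 2 * M e e * ((X e ω ^ 2 - s e) * Q ω)
          + 8 * (X e ω ^ 2 * L ω ^ 2) + 2 * M e e ^ 2 * (X e ω ^ 2 - s e) ^ 2) ∂P := by
      refine integral_mono
        (((hX.allMoments_quadraticForm M (insert e S)).sub (.const _)).pow 2).integrable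
        (((((hQm.pow 2).add i1).add i2).add i3).add i4).integrable fun ω => ?_
      simp only
      rw [quadraticForm_insert hM he, Finset.sum_insert he]
      simp only [hQ, hL]
      nlinarith [sq_nonneg (2 * (X e ω * linForm (M e) S (fun a => X a ω))
        - M e e * (X e ω ^ 2 - s e))]
    refine hle.trans ?_
    rw [integral_add ((((hQm.pow 2).add i1).add i2).add i3).integrable i4.integrable,
      integral_add (((hQm.pow 2).add i1).add i2).integrable i3.integrable,
      integral_add ((hQm.pow 2).add i1).integrable i2.integrable,
      integral_add (hQm.pow 2).integrable i1.integrable]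
    simp only [integral_const_mul]
    have mQ : Measurable (fun x => quadraticForm M S x - m) :=
      (measurable_quadraticForm M S).sub_const _
    have f1 : ∫ ω, X e ω * (Q ω * L ω) ∂P = 0 := by
      have := integral_mul_masked hX.indep hX.measurable he measurable_id
        (mQ.mul (measurable_linForm (M e) S))
      simp only [Pi.mul_apply, linForm_masked, quadraticForm_masked, id, hX.mean, zero_mul] at this
      exact this
    have f2 : ∫ ω, (X e ω ^ 2 - s e) * Q ω ∂P = 0 := by
      have := integral_mul_masked hX.indep hX.measurable he (p := fun x => x ^ 2 - s e)
        (by fun_prop) mQ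
      simp only [quadraticForm_masked] at this
      rw [hQ, this, integral_sub ((hX.allMoments e).pow 2).integrable (integrable_const _), hX.sq]
      simp
    have f3 : ∫ ω, X e ω ^ 2 * L ω ^ 2 ∂P = s e * ∑ a ∈ S, M e a ^ 2 * s a := by
      rw [hL, hX.integral_mul_linForm he (p := fun x => x ^ 2) (by fun_prop) _
        (q := fun x => x ^ 2) (by fun_prop), hX.sq, hX.integral_linForm_sq]
    have g3 : s e * ∑ a ∈ S, M e a ^ 2 * s a ≤ K * ∑ a ∈ S, M e a ^ 2 := by
      rw [Finset.mul_sum, Finset.mul_sum]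
      refine Finset.sum_le_sum fun a _ => ?_
      nlinarith [hX.mul_le e a, sq_nonneg (M e a)]
    have g4 : M e e ^ 2 * ∫ ω, (X e ω ^ 2 - s e) ^ 2 ∂P ≤ M e e ^ 2 * K :=
      mul_le_mul_of_nonneg_left (hX.integral_sq_sub_sq_le e) (sq_nonneg _)
    have g5 : ∑ a ∈ insert e S, ∑ b ∈ insert e S, M a b ^ 2 =
        M e e ^ 2 + 2 * ∑ a ∈ S, M e a ^ 2 + ∑ a ∈ S, ∑ b ∈ S, M a b ^ 2 := by
      simp only [Finset.sum_insert he, Finset.sum_add_distrib]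
      have : ∑ a ∈ S, M a e ^ 2 = ∑ a ∈ S, M e a ^ 2 :=
        Finset.sum_congr rfl fun a _ => by rw [hM a e]
      rw [this]; ring
    have g6 : 0 ≤ K * ∑ a ∈ S, M e a ^ 2 :=
      mul_nonneg (by linarith) (Finset.sum_nonneg fun _ _ => sq_nonneg _)
    have g7 : 0 ≤ M e e ^ 2 * K := mul_nonneg (sq_nonneg _) (by linarith)
    rw [f1, f2, f3, g5]
    nlinarith

theorem integral_quadraticForm (hX : IsCentredFamily P X s K) {A : ι → ι → ℝ}
    (hA : ∀ a b, A a b = A b a) (S : Finset ι) :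
    ∫ ω, quadraticForm A S (fun a => X a ω) ∂P = ∑ a ∈ S, A a a * s a := by
  induction S using Finset.induction_on with
  | empty => simp [quadraticForm]
  | insert e S he ih =>
    have i1 := hX.allMoments_quadraticForm A S
    have i2 := ((hX.allMoments e).mul (hX.allMoments_linForm (A e) S)).const_mul 2
    have i3 := ((hX.allMoments e).pow 2).const_mul (A e e)
    simp only [quadraticForm_insert hA he]
    rw [integral_add (i1.add i2).integrable i3.integrable, integral_add i1.integrable i2.integrable,
      ih, integral_const_mul, integral_const_mul, hX.sq,
      hX.integral_mul_linForm he (p := fun x => x) (by fun_prop) _ (q := fun x => x) (by fun_prop),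
      hX.mean, Finset.sum_insert he]
    ring

end IsCentredFamily

/-! ### Leaving out one variable -/

section Phases

open Complex

theorem norm_cexp_mul_I_sub_one_le (x : ℝ) : ‖cexp (x * I) - 1‖ ≤ |x| := by
  simpa [mul_comm] using Real.norm_exp_I_mul_ofReal_sub_one_le (x := x)

/-- The constant `2` is not optimal, but it makes both cases elementary. -/
theorem norm_cexp_mul_I_sub_one_sub_le (x : ℝ) : ‖cexp (x * I) - 1 - x * I‖ ≤ 2 * x ^ 2 := by
  rcases le_total |x| 1 with h | h
  · have := norm_exp_sub_one_sub_id_le (x := x * I) (by simpa using h)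
    refine this.trans ?_
    simp only [norm_mul, norm_real, Real.norm_eq_abs, norm_I, mul_one, sq_abs]
    nlinarith [sq_nonneg x]
  · calc ‖cexp (x * I) - 1 - x * I‖ ≤ ‖cexp (x * I) - 1‖ + ‖(x : ℂ) * I‖ := norm_sub_le _ _
      _ ≤ |x| + |x| := by
        gcongr
        · exact norm_cexp_mul_I_sub_one_le x
        · simp
      _ ≤ 2 * x ^ 2 := by nlinarith [sq_abs x, abs_nonneg x]

variable {Ω : Type*} [MeasurableSpace Ω] {P : Measure Ω}

theorem integrable_mul_cexp {Z R : Ω → ℝ} (hZ : Integrable Z P) (hR : Measurable R) :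
    Integrable (fun ω => (Z ω : ℂ) * cexp (R ω * I)) P := by
  refine hZ.ofReal.mul_bdd (c := 1) (by fun_prop) (ae_of_all _ fun ω => ?_)
  simp [norm_exp_ofReal_mul_I]

variable [IsProbabilityMeasure P]

theorem integral_abs_le_of_integral_sq_le {Z : Ω → ℝ} (hZ : AllMoments P Z) {η : ℝ} (hη : 0 < η)
    (h : ∫ ω, Z ω ^ 2 ∂P ≤ η ^ 2) : ∫ ω, |Z ω| ∂P ≤ η := by
  have h1 : ∫ ω, |Z ω| ∂P ≤ ∫ ω, (η⁻¹ * Z ω ^ 2 + η) / 2 ∂P := by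
    refine integral_mono hZ.abs.integrable
      ((((hZ.pow 2).const_mul η⁻¹).integrable.add (integrable_const η)).div_const 2) fun ω => ?_
    have h2 : η⁻¹ * Z ω ^ 2 + η - 2 * |Z ω| = η⁻¹ * (|Z ω| - η) ^ 2 := by
      rw [← sq_abs (Z ω)]; field_simp; ring
    have h3 : 0 ≤ η⁻¹ * (|Z ω| - η) ^ 2 := by positivity
    simp only
    linarith
  rw [integral_div, integral_add ((hZ.pow 2).const_mul η⁻¹).integrable (integrable_const η),
    integral_const_mul] at h1
  simp only [integral_const, probReal_univ, smul_eq_mul, one_mul] at h1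
  have h2 : η⁻¹ * ∫ ω, Z ω ^ 2 ∂P ≤ η⁻¹ * η ^ 2 := mul_le_mul_of_nonneg_left h (by positivity)
  have h3 : η⁻¹ * η ^ 2 = η := by field_simp
  linarith

theorem hasDerivAt_integral_cexp {Y : Ω → ℝ} (hY : Integrable Y P) (hm : Measurable Y) (t : ℝ) :
    HasDerivAt (fun t : ℝ => ∫ ω, cexp ((t * Y ω : ℝ) * I) ∂P)
      (I * ∫ ω, (Y ω : ℂ) * cexp ((t * Y ω : ℝ) * I) ∂P) t := by
  have h := hasDerivAt_integral_of_dominated_loc_of_deriv_le (μ := P) (𝕜 := ℝ) (x₀ := t)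
    (F := fun t ω => cexp ((t * Y ω : ℝ) * I))
    (F' := fun t ω => I * ((Y ω : ℂ) * cexp ((t * Y ω : ℝ) * I)))
    (bound := fun ω => |Y ω|) (s := Set.univ) Filter.univ_mem
    (Eventually.of_forall fun u => by fun_prop)
    (by simpa using integrable_mul_cexp (integrable_const (1 : ℝ)) (hm.const_mul t))
    (by fun_prop)
    (ae_of_all _ fun ω u _ => by simp [norm_exp_ofReal_mul_I, -ofReal_mul])
    hY.abs
    (ae_of_all _ fun ω u _ => by
      have h1 : HasDerivAt (fun u : ℝ => ((u * Y ω : ℝ) : ℂ) * I) (Y ω * I) u := by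
        have := ((hasDerivAt_id u).mul_const (Y ω)).ofReal_comp.mul_const I
        simpa using this
      exact h1.cexp.congr_deriv (by ring))
  rw [← integral_const_mul]
  exact h.2

end Phases

namespace IsCentredFamily

open Complex

variable {Ω : Type*} [MeasurableSpace Ω] {P : Measure Ω} [IsProbabilityMeasure P]
  {ι : Type*} [Fintype ι] [DecidableEq ι] {X : ι → Ω → ℝ} {s : ι → ℝ} {K : ℝ}

/-- One step of the leave-one-out expansion. With `D` the coefficient of `X e` in the quadratic
form `Y`, integration by parts in the variable `X e` holds up to third-order terms:
`E[X e * D * exp (i t Y)]` is close to `2 i t * s e * E[D ^ 2 * exp (i t Y)]`. -/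
theorem norm_integral_mul_linForm_sub_le (hX : IsCentredFamily P X s K) {A : ι → ι → ℝ}
    (hA : ∀ a b, A a b = A b a) (hA0 : ∀ a, A a a = 0) {w : ℝ} (hw : 0 < w)
    (hAw : ∀ a, ∑ b, A a b ^ 2 ≤ w ^ 2) (t : ℝ) (e : ι) :
    ‖∫ ω, ((X e ω * linForm (A e) Finset.univ (fun a => X a ω) : ℝ) : ℂ) *
          cexp ((t * quadraticForm A Finset.univ (fun a => X a ω) : ℝ) * I) ∂P
        - 2 * t * I * ∫ ω, ((s e * linForm (A e) Finset.univ (fun a => X a ω) ^ 2 : ℝ) : ℂ) *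
          cexp ((t * quadraticForm A Finset.univ (fun a => X a ω) : ℝ) * I) ∂P‖
      ≤ 48 * t ^ 2 * K ^ 3 * w ^ 3 := by
  set S : Finset ι := Finset.univ.erase e with hS
  have heS : e ∉ S := Finset.notMem_erase e _
  have hins : insert e S = Finset.univ := Finset.insert_erase (Finset.mem_univ e)
  have hlin : ∀ x : ι → ℝ, linForm (A e) Finset.univ x = linForm (A e) S x := by
    intro x
    rw [← hins, linForm, Finset.sum_insert heS, hA0, zero_mul, zero_add, linForm]
  have hquad : ∀ x : ι → ℝ, quadraticForm A Finset.univ x =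
      quadraticForm A S x + 2 * (x e * linForm (A e) S x) := by
    intro x
    rw [← hins, quadraticForm_insert hA heS, hA0, zero_mul, add_zero]
  simp only [hlin]
  set D : Ω → ℝ := fun ω => linForm (A e) S (fun a => X a ω) with hD
  set Y : Ω → ℝ := fun ω => quadraticForm A Finset.univ (fun a => X a ω) with hY
  set Z : Ω → ℝ := fun ω => quadraticForm A S (fun a => X a ω) with hZ
  have hYZ : ∀ ω, Y ω = Z ω + 2 * (X e ω * D ω) := fun ω => hquad _
  have hDm : AllMoments P D := hX.allMoments_linForm _ S
  have hXm := hX.allMoments e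
  have hxm : Measurable fun ω => fun a => X a ω := measurable_pi_lambda _ hX.measurable
  have mY : Measurable Y := (measurable_quadraticForm A Finset.univ).comp hxm
  have mZ : Measurable Z := (measurable_quadraticForm A S).comp hxm
  have hK := hX.one_le
  have hD3 : ∫ ω, |D ω| ^ 3 ∂P ≤ 4 * K * w ^ 3 := by
    refine hX.integral_abs_linForm_cube_le (A e) S hw (le_trans ?_ (hAw e))
    exact Finset.sum_le_univ_sum_of_nonneg fun _ => sq_nonneg _
  have hD30 : 0 ≤ ∫ ω, |D ω| ^ 3 ∂P := integral_nonneg fun _ => by positivity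
  -- the first-order term vanishes, and the second-order one factors
  have hfirst : ∫ ω, ((X e ω * D ω : ℝ) : ℂ) * cexp ((t * Z ω : ℝ) * I) ∂P = 0 := by
    have mF : Measurable fun x : ι → ℝ =>
        (linForm (A e) S x : ℂ) * cexp ((t * quadraticForm A S x : ℝ) * I) := by
      have := measurable_linForm (A e) S
      have := measurable_quadraticForm A S
      fun_prop
    have := integral_mul_masked hX.indep hX.measurable heS (p := fun x : ℝ => (x : ℂ))
      (by fun_prop) mF
    simp only [linForm_masked, quadraticForm_masked] at this
    rw [integral_complex_ofReal, hX.mean, ofReal_zero, zero_mul] at this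
    rw [← this]
    refine integral_congr_ae (ae_of_all _ fun ω => ?_)
    simp only [hD, hZ]; push_cast; ring
  have hsecond : ∫ ω, ((X e ω ^ 2 * D ω ^ 2 : ℝ) : ℂ) * cexp ((t * Z ω : ℝ) * I) ∂P =
      ∫ ω, ((s e * D ω ^ 2 : ℝ) : ℂ) * cexp ((t * Z ω : ℝ) * I) ∂P := by
    have mF : Measurable fun x : ι → ℝ =>
        ((linForm (A e) S x ^ 2 : ℝ) : ℂ) * cexp ((t * quadraticForm A S x : ℝ) * I) := by
      have := measurable_linForm (A e) S
      have := measurable_quadraticForm A S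
      fun_prop
    have := integral_mul_masked hX.indep hX.measurable heS (p := fun x : ℝ => ((x ^ 2 : ℝ) : ℂ))
      (by fun_prop) mF
    simp only [linForm_masked, quadraticForm_masked] at this
    rw [integral_complex_ofReal, hX.sq, ← integral_const_mul] at this
    refine Eq.trans ?_ (this.trans ?_) <;> refine integral_congr_ae (ae_of_all _ fun ω => ?_) <;>
    · simp only [hD, hZ]; push_cast; ring
  -- integrability of the terms involved
  have i1 := integrable_mul_cexp (hXm.mul hDm).integrable (mY.const_mul t)
  have i2 := integrable_mul_cexp (hXm.mul hDm).integrable (mZ.const_mul t)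
  have i3 := integrable_mul_cexp ((hXm.pow 2).mul (hDm.pow 2)).integrable (mZ.const_mul t)
  have i4 := integrable_mul_cexp ((hDm.pow 2).const_mul (s e)).integrable (mZ.const_mul t)
  have i5 := integrable_mul_cexp ((hDm.pow 2).const_mul (s e)).integrable (mY.const_mul t)
  have i12 : Integrable (fun ω => ((X e ω * D ω : ℝ) : ℂ) * cexp ((t * Y ω : ℝ) * I)
      - ((X e ω * D ω : ℝ) : ℂ) * cexp ((t * Z ω : ℝ) * I)) P := i1.sub i2
  have hsplit : ∫ ω, ((X e ω * D ω : ℝ) : ℂ) * cexp ((t * Y ω : ℝ) * I) ∂P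
        - 2 * t * I * ∫ ω, ((s e * D ω ^ 2 : ℝ) : ℂ) * cexp ((t * Y ω : ℝ) * I) ∂P =
      ∫ ω, (((X e ω * D ω : ℝ) : ℂ) * cexp ((t * Y ω : ℝ) * I)
        - ((X e ω * D ω : ℝ) : ℂ) * cexp ((t * Z ω : ℝ) * I)
        - 2 * t * I * (((X e ω ^ 2 * D ω ^ 2 : ℝ) : ℂ) * cexp ((t * Z ω : ℝ) * I))) ∂P
      + 2 * t * I * ∫ ω, (((s e * D ω ^ 2 : ℝ) : ℂ) * cexp ((t * Z ω : ℝ) * I)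
        - ((s e * D ω ^ 2 : ℝ) : ℂ) * cexp ((t * Y ω : ℝ) * I)) ∂P := by
    rw [integral_sub i12 (i3.const_mul _), integral_sub i1 i2, integral_sub i4 i5,
      integral_const_mul, hfirst, hsecond]
    ring
  have hphase : ∀ ω, cexp ((t * Y ω : ℝ) * I) =
      cexp ((t * Z ω : ℝ) * I) * cexp ((2 * t * (X e ω * D ω) : ℝ) * I) := by
    intro ω
    rw [← Complex.exp_add, hYZ]
    congr 1
    push_cast; ring
  have hb1 : ‖∫ ω, (((X e ω * D ω : ℝ) : ℂ) * cexp ((t * Y ω : ℝ) * I)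
        - ((X e ω * D ω : ℝ) : ℂ) * cexp ((t * Z ω : ℝ) * I)
        - 2 * t * I * (((X e ω ^ 2 * D ω ^ 2 : ℝ) : ℂ) * cexp ((t * Z ω : ℝ) * I))) ∂P‖
      ≤ 8 * t ^ 2 * (K * (4 * K * w ^ 3)) := by
    have h1 : ∫ ω, 8 * t ^ 2 * (|X e ω| ^ 3 * |D ω| ^ 3) ∂P ≤
        8 * t ^ 2 * (K * (4 * K * w ^ 3)) := by
      rw [integral_const_mul, hX.integral_mul_linForm heS (p := fun x => |x| ^ 3) (by fun_prop) _
        (q := fun x => |x| ^ 3) (by fun_prop)]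
      exact mul_le_mul_of_nonneg_left
        (mul_le_mul (hX.abs_cube_le e) hD3 hD30 (by linarith)) (by positivity)
    refine (norm_integral_le_of_norm_le
      (((hXm.abs.pow 3).mul (hDm.abs.pow 3)).const_mul _).integrable
      (ae_of_all _ fun ω => ?_)).trans h1
    have h2 : ((X e ω * D ω : ℝ) : ℂ) * cexp ((t * Y ω : ℝ) * I)
        - ((X e ω * D ω : ℝ) : ℂ) * cexp ((t * Z ω : ℝ) * I)
        - 2 * t * I * (((X e ω ^ 2 * D ω ^ 2 : ℝ) : ℂ) * cexp ((t * Z ω : ℝ) * I)) =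
        ((X e ω * D ω : ℝ) : ℂ) * cexp ((t * Z ω : ℝ) * I) *
          (cexp ((2 * t * (X e ω * D ω) : ℝ) * I) - 1 - (2 * t * (X e ω * D ω) : ℝ) * I) := by
      rw [hphase]; push_cast; ring
    rw [h2, norm_mul, norm_mul, norm_exp_ofReal_mul_I, mul_one, norm_real, Real.norm_eq_abs]
    refine (mul_le_mul_of_nonneg_left (norm_cexp_mul_I_sub_one_sub_le _) (abs_nonneg _)).trans
      (le_of_eq ?_)
    rw [← mul_pow, ← abs_mul, pow_succ |X e ω * D ω| 2, sq_abs]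
    ring
  have hb2 : ‖∫ ω, (((s e * D ω ^ 2 : ℝ) : ℂ) * cexp ((t * Z ω : ℝ) * I)
        - ((s e * D ω ^ 2 : ℝ) : ℂ) * cexp ((t * Y ω : ℝ) * I)) ∂P‖
      ≤ s e * (2 * |t|) * (K * (4 * K * w ^ 3)) := by
    have h1 : ∫ ω, s e * (2 * |t|) * (|X e ω| * |D ω| ^ 3) ∂P ≤
        s e * (2 * |t|) * (K * (4 * K * w ^ 3)) := by
      rw [integral_const_mul, hX.integral_mul_linForm heS (p := fun x => |x|) (by fun_prop) _
        (q := fun x => |x| ^ 3) (by fun_prop)]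
      exact mul_le_mul_of_nonneg_left
        (mul_le_mul (hX.abs_le e) hD3 hD30 (by linarith))
        (mul_nonneg (hX.nonneg e) (by positivity))
    refine (norm_integral_le_of_norm_le
      ((hXm.abs.mul (hDm.abs.pow 3)).const_mul _).integrable
      (ae_of_all _ fun ω => ?_)).trans h1
    have h2 : ((s e * D ω ^ 2 : ℝ) : ℂ) * cexp ((t * Z ω : ℝ) * I)
        - ((s e * D ω ^ 2 : ℝ) : ℂ) * cexp ((t * Y ω : ℝ) * I) =
        -(((s e * D ω ^ 2 : ℝ) : ℂ) * cexp ((t * Z ω : ℝ) * I) *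
          (cexp ((2 * t * (X e ω * D ω) : ℝ) * I) - 1)) := by
      rw [hphase]; ring
    rw [h2, norm_neg, norm_mul, norm_mul, norm_exp_ofReal_mul_I, mul_one, norm_real,
      Real.norm_eq_abs, abs_of_nonneg (mul_nonneg (hX.nonneg e) (sq_nonneg _))]
    refine (mul_le_mul_of_nonneg_left (norm_cexp_mul_I_sub_one_le _)
      (mul_nonneg (hX.nonneg e) (sq_nonneg _))).trans (le_of_eq ?_)
    rw [abs_mul, abs_mul, abs_mul, abs_two, pow_succ |D ω| 2, sq_abs]
    ring
  rw [hsplit]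
  refine (norm_add_le _ _).trans ?_
  rw [norm_mul, norm_mul, norm_mul, norm_I, norm_real, Real.norm_eq_abs, mul_one,
    Complex.norm_ofNat]
  have hb3 : s e * (2 * |t|) * (K * (4 * K * w ^ 3)) ≤ K * (2 * |t|) * (K * (4 * K * w ^ 3)) := by
    have := hX.le e
    gcongr
  have hb4 : 2 * |t| * (K * (2 * |t|) * (K * (4 * K * w ^ 3))) = 16 * t ^ 2 * K ^ 3 * w ^ 3 := by
    rw [← sq_abs t]; ring
  have hb5 : 8 * t ^ 2 * (K * (4 * K * w ^ 3)) ≤ 32 * t ^ 2 * K ^ 3 * w ^ 3 := by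
    have : 0 ≤ 32 * t ^ 2 * K ^ 2 * w ^ 3 := by positivity
    nlinarith
  have hb6 := mul_le_mul_of_nonneg_left (hb2.trans hb3) (by positivity : 0 ≤ 2 * |t|)
  linarith

end IsCentredFamily

/-! ### Central limit theorem for quadratic forms -/

namespace IsCentredFamily

open Complex

variable {Ω : Type*} [MeasurableSpace Ω] {P : Measure Ω} [IsProbabilityMeasure P]
  {ι : Type*} [Fintype ι] [DecidableEq ι] {X : ι → Ω → ℝ} {s : ι → ℝ} {K : ℝ}

/-- The characteristic function `φ` of the quadratic form almost solves `φ' = - v t φ`, the equation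
satisfied by `exp (- v t ^ 2 / 2)`. -/
theorem norm_integral_quadraticForm_add_le (hX : IsCentredFamily P X s K) {A : ι → ι → ℝ}
    (hA : ∀ a b, A a b = A b a) (hA0 : ∀ a, A a a = 0) {w : ℝ} (hw : 0 < w)
    (hAw : ∀ a, ∑ b, A a b ^ 2 ≤ w ^ 2) {η : ℝ} (hη : 0 < η)
    (hAη : 8 * K * ∑ a, ∑ b, (∑ e, s e * (A e a * A e b)) ^ 2 ≤ η ^ 2) (t : ℝ) :
    ‖I * ∫ ω, ((quadraticForm A Finset.univ (fun a => X a ω) : ℝ) : ℂ) *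
          cexp ((t * quadraticForm A Finset.univ (fun a => X a ω) : ℝ) * I) ∂P
        + (2 * ∑ a, ∑ b, A a b ^ 2 * (s a * s b) : ℝ) * t *
          ∫ ω, cexp ((t * quadraticForm A Finset.univ (fun a => X a ω) : ℝ) * I) ∂P‖
      ≤ Fintype.card ι * (48 * t ^ 2 * K ^ 3 * w ^ 3) + 2 * |t| * η := by
  set Y : Ω → ℝ := fun ω => quadraticForm A Finset.univ (fun a => X a ω) with hY
  set D : ι → Ω → ℝ := fun e ω => linForm (A e) Finset.univ (fun a => X a ω) with hD
  set v : ℝ := 2 * ∑ a, ∑ b, A a b ^ 2 * (s a * s b) with hv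
  have hxm : Measurable fun ω => fun a => X a ω := measurable_pi_lambda _ hX.measurable
  have mtY : Measurable fun ω => t * Y ω :=
    ((measurable_quadraticForm A Finset.univ).comp hxm).const_mul t
  have hDm : ∀ e, AllMoments P (D e) := fun e => hX.allMoments_linForm _ _
  set Q : Ω → ℝ := fun ω => ∑ e, s e * D e ω ^ 2 with hQ
  have hQm : AllMoments P Q := AllMoments.sum _ fun e _ => ((hDm e).pow 2).const_mul _
  -- `Q` is a quadratic form too, and concentrates around its mean `v / 2`
  set M : ι → ι → ℝ := fun a b => ∑ e, s e * (A e a * A e b) with hM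
  have hQM : ∀ ω, Q ω = quadraticForm M Finset.univ (fun a => X a ω) := by
    intro ω
    have h1 : ∀ e, s e * D e ω ^ 2 =
        ∑ a, ∑ b, s e * (A e a * A e b) * (X a ω * X b ω) := by
      intro e
      simp only [hD, linForm]
      rw [pow_two, Finset.sum_mul_sum, Finset.mul_sum]
      refine Finset.sum_congr rfl fun a _ => ?_
      rw [Finset.mul_sum]
      exact Finset.sum_congr rfl fun b _ => by ring
    simp only [hQ, h1, quadraticForm, hM, Finset.sum_mul]
    rw [Finset.sum_comm]
    exact Finset.sum_congr rfl fun a _ => Finset.sum_comm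
  have hMtr : ∑ a, M a a * s a = v / 2 := by
    rw [hv, mul_div_cancel_left₀ _ two_ne_zero, Finset.sum_comm]
    refine Finset.sum_congr rfl fun a _ => ?_
    rw [hM, Finset.sum_mul]
    exact Finset.sum_congr rfl fun b _ => by ring
  have hQvar : ∫ ω, |Q ω - v / 2| ∂P ≤ η := by
    refine integral_abs_le_of_integral_sq_le (hQm.sub (.const _)) hη (le_trans ?_ hAη)
    have := hX.integral_quadraticForm_sub_sq_le (M := M)
      (fun a b => Finset.sum_congr rfl fun e _ => by ring) Finset.univ
    rw [hMtr] at this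
    simpa only [hQM] using this
  have iYe := integrable_mul_cexp (hX.allMoments_quadraticForm A Finset.univ).integrable mtY
  have iX : ∀ e, Integrable (fun ω => ((X e ω * D e ω : ℝ) : ℂ) * cexp ((t * Y ω : ℝ) * I)) P :=
    fun e => integrable_mul_cexp ((hX.allMoments e).mul (hDm e)).integrable mtY
  have iD : ∀ e, Integrable (fun ω => ((s e * D e ω ^ 2 : ℝ) : ℂ) * cexp ((t * Y ω : ℝ) * I)) P :=
    fun e => integrable_mul_cexp (((hDm e).pow 2).const_mul _).integrable mtY
  have iQ := integrable_mul_cexp hQm.integrable mtY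
  have i1 : Integrable (fun ω => cexp ((t * Y ω : ℝ) * I)) P := by
    simpa using integrable_mul_cexp (integrable_const (1 : ℝ)) mtY
  have hsumY : ∫ ω, ((Y ω : ℝ) : ℂ) * cexp ((t * Y ω : ℝ) * I) ∂P =
      ∑ e, ∫ ω, ((X e ω * D e ω : ℝ) : ℂ) * cexp ((t * Y ω : ℝ) * I) ∂P := by
    rw [← integral_finsetSum _ fun e _ => iX e]
    refine integral_congr_ae (ae_of_all _ fun ω => ?_)
    simp only
    rw [← Finset.sum_mul, ← ofReal_sum]
    congr 2
    simp only [hY, hD, quadraticForm, linForm, Finset.mul_sum]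
    exact Finset.sum_congr rfl fun a _ => Finset.sum_congr rfl fun b _ => by ring
  have hsumQ : ∫ ω, ((Q ω : ℝ) : ℂ) * cexp ((t * Y ω : ℝ) * I) ∂P =
      ∑ e, ∫ ω, ((s e * D e ω ^ 2 : ℝ) : ℂ) * cexp ((t * Y ω : ℝ) * I) ∂P := by
    rw [← integral_finsetSum _ fun e _ => iD e]
    refine integral_congr_ae (ae_of_all _ fun ω => ?_)
    simp only
    rw [← Finset.sum_mul, ← ofReal_sum]
  have hb1 : ‖∫ ω, ((Y ω : ℝ) : ℂ) * cexp ((t * Y ω : ℝ) * I) ∂P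
      - 2 * t * I * ∫ ω, ((Q ω : ℝ) : ℂ) * cexp ((t * Y ω : ℝ) * I) ∂P‖ ≤
      Fintype.card ι * (48 * t ^ 2 * K ^ 3 * w ^ 3) := by
    rw [hsumY, hsumQ, Finset.mul_sum, ← Finset.sum_sub_distrib]
    refine (norm_sum_le_of_le _ fun e _ =>
      hX.norm_integral_mul_linForm_sub_le hA hA0 hw hAw t e).trans (le_of_eq ?_)
    simp
  have hb2 : ‖∫ ω, ((Q ω : ℝ) : ℂ) * cexp ((t * Y ω : ℝ) * I) ∂P
      - (v / 2 : ℝ) * ∫ ω, cexp ((t * Y ω : ℝ) * I) ∂P‖ ≤ η := by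
    rw [← integral_const_mul, ← integral_sub iQ (i1.const_mul _)]
    refine (norm_integral_le_of_norm_le (hQm.sub (.const (v / 2))).abs.integrable
      (ae_of_all _ fun ω => ?_)).trans hQvar
    rw [← sub_mul, norm_mul, norm_exp_ofReal_mul_I, mul_one, ← ofReal_sub, norm_real,
      Real.norm_eq_abs]
  have hsplit : I * ∫ ω, ((Y ω : ℝ) : ℂ) * cexp ((t * Y ω : ℝ) * I) ∂P
        + (v : ℝ) * t * ∫ ω, cexp ((t * Y ω : ℝ) * I) ∂P =
      I * (∫ ω, ((Y ω : ℝ) : ℂ) * cexp ((t * Y ω : ℝ) * I) ∂P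
        - 2 * t * I * ∫ ω, ((Q ω : ℝ) : ℂ) * cexp ((t * Y ω : ℝ) * I) ∂P)
      - 2 * t * (∫ ω, ((Q ω : ℝ) : ℂ) * cexp ((t * Y ω : ℝ) * I) ∂P
        - (v / 2 : ℝ) * ∫ ω, cexp ((t * Y ω : ℝ) * I) ∂P) := by
    simp only [ofReal_div, ofReal_ofNat]
    linear_combination (2 * t * ∫ ω, ((Q ω : ℝ) : ℂ) * cexp ((t * Y ω : ℝ) * I) ∂P) * I_mul_I
  rw [hsplit]
  refine (norm_sub_le _ _).trans ?_
  rw [norm_mul, norm_mul, norm_mul, norm_I, one_mul, norm_real, Real.norm_eq_abs,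
    Complex.norm_ofNat]
  exact add_le_add hb1 (mul_le_mul_of_nonneg_left hb2 (by positivity))

/-- Quantitative central limit theorem for quadratic forms without diagonal, in terms of
characteristic functions. -/
theorem norm_charFun_quadraticForm_sub_le (hX : IsCentredFamily P X s K) {A : ι → ι → ℝ}
    (hA : ∀ a b, A a b = A b a) (hA0 : ∀ a, A a a = 0) {w : ℝ} (hw : 0 < w)
    (hAw : ∀ a, ∑ b, A a b ^ 2 ≤ w ^ 2) {η : ℝ} (hη : 0 < η)
    (hAη : 8 * K * ∑ a, ∑ b, (∑ e, s e * (A e a * A e b)) ^ 2 ≤ η ^ 2) {v : ℝ}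
    (hv : 2 * ∑ a, ∑ b, A a b ^ 2 * (s a * s b) = v) (t : ℝ) :
    ‖∫ ω, cexp ((t * quadraticForm A Finset.univ (fun a => X a ω) : ℝ) * I) ∂P
        - Real.exp (-(v * t ^ 2 / 2))‖
      ≤ (Fintype.card ι * (48 * t ^ 2 * K ^ 3 * w ^ 3) + 2 * |t| * η) * |t| := by
  set Y : Ω → ℝ := fun ω => quadraticForm A Finset.univ (fun a => X a ω) with hY
  set φ : ℝ → ℂ := fun u => ∫ ω, cexp ((u * Y ω : ℝ) * I) ∂P with hφ
  have hxm : Measurable fun ω => fun a => X a ω := measurable_pi_lambda _ hX.measurable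
  have hYm : AllMoments P Y := hX.allMoments_quadraticForm A Finset.univ
  have mY : Measurable Y := (measurable_quadraticForm A Finset.univ).comp hxm
  have hv0 : 0 ≤ v := by
    rw [← hv]
    exact mul_nonneg zero_le_two (Finset.sum_nonneg fun a _ => Finset.sum_nonneg fun b _ =>
      mul_nonneg (sq_nonneg _) (mul_nonneg (hX.nonneg a) (hX.nonneg b)))
  have hK := hX.one_le
  set E : ℝ → ℝ := fun u => Real.exp (v * u ^ 2 / 2) with hE
  have hEd : ∀ u, HasDerivAt E (E u * (v * u)) u := by
    intro u
    have h := ((hasDerivAt_pow 2 u).const_mul v).div_const 2 |>.exp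
    exact h.congr_deriv (by simp only [hE]; push_cast; ring)
  -- the derivative of `φ u * exp (v u ^ 2 / 2)` is small on the segment from `0` to `t`
  have hder : ∀ u, HasDerivAt (fun u => φ u * (E u : ℂ))
      ((I * ∫ ω, (Y ω : ℂ) * cexp ((u * Y ω : ℝ) * I) ∂P + v * u * φ u) * E u) u := by
    intro u
    have h1 : HasDerivAt φ _ u := hasDerivAt_integral_cexp hYm.integrable mY u
    refine (h1.mul (hEd u).ofReal_comp).congr_deriv ?_
    rw [ofReal_mul (E u), ofReal_mul v]
    ring
  have hbound : ∀ u ∈ Set.uIcc 0 t,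
      ‖(I * ∫ ω, (Y ω : ℂ) * cexp ((u * Y ω : ℝ) * I) ∂P + v * u * φ u) * E u‖ ≤
        (Fintype.card ι * (48 * t ^ 2 * K ^ 3 * w ^ 3) + 2 * |t| * η) * E t := by
    intro u hu
    have hut : |u| ≤ |t| := by simpa using Set.abs_sub_left_of_mem_uIcc hu
    have hut2 : u ^ 2 ≤ t ^ 2 := sq_le_sq.2 hut
    have h1 := hX.norm_integral_quadraticForm_add_le hA hA0 hw hAw hη hAη u
    rw [hv] at h1
    rw [norm_mul, norm_real, Real.norm_eq_abs, abs_of_pos (Real.exp_pos _)]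
    have h2 : E u ≤ E t := Real.exp_le_exp.2 (by nlinarith)
    refine mul_le_mul (h1.trans ?_) h2 (Real.exp_pos _).le (by positivity)
    gcongr
  have hmain := (convex_uIcc (0 : ℝ) t).norm_image_sub_le_of_norm_hasDerivWithin_le
    (fun u _ => (hder u).hasDerivWithinAt) hbound Set.left_mem_uIcc Set.right_mem_uIcc
  have h0 : φ 0 * (E 0 : ℂ) = 1 := by simp [hφ, hE]
  have hEt : 0 < E t := Real.exp_pos _
  have hinv : Real.exp (-(v * t ^ 2 / 2)) = (E t)⁻¹ := Real.exp_neg _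
  rw [h0, sub_zero, Real.norm_eq_abs] at hmain
  have hfin : φ t - ((E t)⁻¹ : ℝ) = (φ t * (E t : ℂ) - 1) * ((E t)⁻¹ : ℝ) := by
    have : (E t : ℂ) ≠ 0 := by exact_mod_cast hEt.ne'
    push_cast
    field_simp
  rw [hinv, hfin, norm_mul, norm_real, Real.norm_eq_abs, abs_of_pos (inv_pos.2 hEt)]
  calc _ ≤ ((Fintype.card ι * (48 * t ^ 2 * K ^ 3 * w ^ 3) + 2 * |t| * η) * E t * |t|)
        * (E t)⁻¹ := mul_le_mul_of_nonneg_right hmain (inv_pos.2 hEt).le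
    _ = _ := by field_simp

/-- Quantitative central limit theorem for centred quadratic forms: the diagonal contributes a sum
of independent variables, which is small in mean square. -/
theorem norm_charFun_quadraticForm_sub_diag_le (hX : IsCentredFamily P X s K) {A : ι → ι → ℝ}
    (hA : ∀ a b, A a b = A b a) {w : ℝ} (hw : 0 < w)
    (hAw : ∀ a, ∑ b, A a b ^ 2 ≤ w ^ 2) {η : ℝ} (hη : 0 < η)
    (hAη : 8 * K * (K ^ 2 * ∑ a, ∑ b, (∑ e, |A e a| * |A e b|) ^ 2) ≤ η ^ 2)
    (hAd : 8 * K * ∑ a, A a a ^ 2 ≤ η ^ 2) {v : ℝ}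
    (hv : 2 * (∑ a, ∑ b, A a b ^ 2 * (s a * s b) - ∑ a, A a a ^ 2 * (s a * s a)) = v) (t : ℝ) :
    ‖∫ ω, cexp ((t * (quadraticForm A Finset.univ (fun a => X a ω)
          - ∑ a, A a a * s a) : ℝ) * I) ∂P - Real.exp (-(v * t ^ 2 / 2))‖
      ≤ (Fintype.card ι * (48 * t ^ 2 * K ^ 3 * w ^ 3) + 2 * |t| * η) * |t| + |t| * η := by
  have hK := hX.one_le
  -- the off-diagonal and the diagonal part of `A`
  set A0 : ι → ι → ℝ := fun a b => if a = b then 0 else A a b with hA0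
  set Ad : ι → ι → ℝ := fun a b => if a = b then A a b else 0 with hAdef
  have hadd : ∀ a b, A a b = A0 a b + Ad a b := by
    intro a b; simp only [hA0, hAdef]; split_ifs <;> simp
  have habs : ∀ a b, |A0 a b| ≤ |A a b| := by
    intro a b; simp only [hA0]; split_ifs <;> simp
  have hsym0 : ∀ a b, A0 a b = A0 b a := by
    intro a b; simp only [hA0, hA a b, eq_comm]
  have hsymd : ∀ a b, Ad a b = Ad b a := by
    intro a b; simp only [hAdef, hA a b, eq_comm]
  have hAdd : ∀ a, Ad a a = A a a := fun a => by simp [hAdef]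
  have hYsplit : ∀ x, quadraticForm A Finset.univ x
      = quadraticForm A0 Finset.univ x + quadraticForm Ad Finset.univ x := by
    intro x
    simp only [quadraticForm, ← Finset.sum_add_distrib]
    exact Finset.sum_congr rfl fun a _ => Finset.sum_congr rfl fun b _ => by
      rw [hadd]; ring
  have hw0 : ∀ a, ∑ b, A0 a b ^ 2 ≤ w ^ 2 := fun a =>
    (Finset.sum_le_sum fun b _ => sq_le_sq.2 (habs a b)).trans (hAw a)
  have hη0 : 8 * K * ∑ a, ∑ b, (∑ e, s e * (A0 e a * A0 e b)) ^ 2 ≤ η ^ 2 := by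
    refine le_trans (mul_le_mul_of_nonneg_left ?_ (by linarith)) hAη
    rw [Finset.mul_sum]
    refine Finset.sum_le_sum fun a _ => ?_
    rw [Finset.mul_sum]
    refine Finset.sum_le_sum fun b _ => ?_
    rw [← mul_pow]
    refine sq_le_sq.2 ((Finset.abs_sum_le_sum_abs _ _).trans (le_trans ?_ (le_abs_self _)))
    rw [Finset.mul_sum]
    refine Finset.sum_le_sum fun e _ => ?_
    rw [abs_mul, abs_mul, abs_of_nonneg (hX.nonneg e)]
    have := hX.le e
    have := habs e a
    have := habs e b
    gcongr
  have hv0 : 2 * ∑ a, ∑ b, A0 a b ^ 2 * (s a * s b) = v := by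
    rw [← hv, ← Finset.sum_sub_distrib]
    congr 1
    refine Finset.sum_congr rfl fun a _ => ?_
    rw [eq_sub_iff_add_eq, ← Finset.sum_erase_add _ _ (Finset.mem_univ a),
      ← Finset.sum_erase_add (f := fun b => A a b ^ 2 * (s a * s b)) _ (Finset.mem_univ a)]
    have : ∑ b ∈ Finset.univ.erase a, A0 a b ^ 2 * (s a * s b) =
        ∑ b ∈ Finset.univ.erase a, A a b ^ 2 * (s a * s b) :=
      Finset.sum_congr rfl fun b hb => by
        simp only [hA0, if_neg (Finset.ne_of_mem_erase hb).symm]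
    rw [this]
    simp [hA0]
  have hmain := hX.norm_charFun_quadraticForm_sub_le hsym0 (fun a => by simp [hA0]) hw hw0 hη hη0
    hv0 t
  set Y0 : Ω → ℝ := fun ω => quadraticForm A0 Finset.univ (fun a => X a ω) with hY0
  set R : Ω → ℝ := fun ω => quadraticForm Ad Finset.univ (fun a => X a ω) - ∑ a, A a a * s a
    with hR
  have hxm : Measurable fun ω => fun a => X a ω := measurable_pi_lambda _ hX.measurable
  have mY0 : Measurable Y0 := (measurable_quadraticForm A0 Finset.univ).comp hxm
  have mR : Measurable R := ((measurable_quadraticForm Ad Finset.univ).comp hxm).sub_const _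
  have hRm : AllMoments P R := (hX.allMoments_quadraticForm Ad Finset.univ).sub (.const _)
  have hRle : ∫ ω, |R ω| ∂P ≤ η := by
    refine integral_abs_le_of_integral_sq_le hRm hη (le_trans ?_ hAd)
    have h1 := hX.integral_quadraticForm_sub_sq_le hsymd Finset.univ
    simp only [hAdd] at h1
    refine h1.trans (le_of_eq ?_)
    congr 1
    refine Finset.sum_congr rfl fun a _ => ?_
    simp [hAdef]
  have hphase : ∀ ω, cexp ((t * (quadraticForm A Finset.univ (fun a => X a ω)
      - ∑ a, A a a * s a) : ℝ) * I) =
      cexp ((t * Y0 ω : ℝ) * I) * cexp ((t * R ω : ℝ) * I) := by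
    intro ω
    rw [← Complex.exp_add, hYsplit]
    congr 1
    simp only [hY0, hR]
    push_cast
    ring
  have hdiff : ‖∫ ω, cexp ((t * Y0 ω : ℝ) * I) * cexp ((t * R ω : ℝ) * I) ∂P
      - ∫ ω, cexp ((t * Y0 ω : ℝ) * I) ∂P‖ ≤ |t| * η := by
    have i1 : Integrable (fun ω => cexp ((t * Y0 ω : ℝ) * I)) P := by
      simpa using integrable_mul_cexp (integrable_const (1 : ℝ)) (mY0.const_mul t)
    have i2 : Integrable (fun ω => cexp ((t * Y0 ω : ℝ) * I) * cexp ((t * R ω : ℝ) * I)) P := by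
      refine i1.mul_bdd (c := 1) (by fun_prop) (ae_of_all _ fun ω => ?_)
      simp only [norm_exp_ofReal_mul_I, le_refl]
    rw [← integral_sub i2 i1]
    have h1 : ∫ ω, |t| * |R ω| ∂P ≤ |t| * η := by
      rw [integral_const_mul]
      exact mul_le_mul_of_nonneg_left hRle (abs_nonneg _)
    refine (norm_integral_le_of_norm_le (hRm.abs.const_mul |t|).integrable
      (ae_of_all _ fun ω => ?_)).trans h1
    rw [← mul_sub_one, norm_mul, norm_exp_ofReal_mul_I, one_mul, ← abs_mul]
    exact norm_cexp_mul_I_sub_one_le _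
  simp only [hphase]
  calc _ ≤ ‖∫ ω, cexp ((t * Y0 ω : ℝ) * I) * cexp ((t * R ω : ℝ) * I) ∂P
          - ∫ ω, cexp ((t * Y0 ω : ℝ) * I) ∂P‖
        + ‖∫ ω, cexp ((t * Y0 ω : ℝ) * I) ∂P - Real.exp (-(v * t ^ 2 / 2))‖ :=
        norm_sub_le_norm_sub_add_norm_sub _ _ _
    _ ≤ _ := by linarith

end IsCentredFamily

/-! ### Edges of the complete graph and their incidences -/

/-- The edges `{j, l}` (loops included) of the complete graph on `Fin N`, which index the
independent entries of the random matrix; the smaller endpoint comes first. -/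
abbrev Edge (N : ℕ) : Type := {p : Fin N × Fin N // p.1 ≤ p.2}

namespace Edge

variable {N : ℕ}

/-- The edge with endpoints `j` and `l`. -/
def mk (j l : Fin N) : Edge N := ⟨(min j l, max j l), min_le_max⟩

theorem mk_comm (j l : Fin N) : mk j l = mk l j := by
  simp only [mk, min_comm, max_comm]

/-- `j` is an endpoint of `e`. -/
def Has (e : Edge N) (j : Fin N) : Prop := e.1.1 = j ∨ e.1.2 = j

instance (e : Edge N) (j : Fin N) : Decidable (e.Has j) := by unfold Has; infer_instance

theorem has_mk {j l k : Fin N} : (mk j l).Has k ↔ j = k ∨ l = k := by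
  rcases le_total j l with h | h
  · simp [mk, Has, h]
  · simp [mk, Has, h, or_comm]

/-- The endpoint of `e` other than `j` (`j` itself for a loop), if `j` is an endpoint of `e`; the
value is irrelevant otherwise. -/
def other (e : Edge N) (j : Fin N) : Fin N := if e.1.1 = j then e.1.2 else e.1.1

theorem other_mk (j l : Fin N) : (mk j l).other j = l := by
  rcases le_total j l with h | h
  · simp [mk, other, h]
  · rcases eq_or_ne l j with rfl | h'
    · simp [mk, other]
    · simp [mk, other, h, h']

theorem mk_other {e : Edge N} {j : Fin N} (h : e.Has j) : mk j (e.other j) = e := by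
  obtain ⟨⟨a, b⟩, hab⟩ := e
  simp only at hab
  rcases eq_or_ne a j with rfl | h'
  · simp [mk, other, hab]
  · have hb : b = j := by simpa [Has, h'] using h
    subst hb
    simp [mk, other, h', hab]

theorem eq_of_has {e e' : Edge N} {j k : Fin N} (hjk : j ≠ k) (h1 : e.Has j) (h2 : e.Has k)
    (h1' : e'.Has j) (h2' : e'.Has k) : e = e' := by
  rw [← mk_other h1, has_mk] at h2
  rw [← mk_other h1', has_mk] at h2'
  rw [← mk_other h1, ← mk_other h1', h2.resolve_left hjk, h2'.resolve_left hjk]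

/-- The edges at `j` correspond to the possible other endpoints. -/
theorem sum_ite_has (j : Fin N) (F : Edge N → ℝ) :
    ∑ e : Edge N, (if e.Has j then F e else 0) = ∑ l, F (mk j l) := by
  rw [← Finset.sum_filter]
  symm
  refine Finset.sum_bij' (fun l _ => mk j l) (fun e _ => e.other j) ?_ ?_ ?_ ?_ ?_
  · intro l _
    simp [has_mk]
  · simp
  · intro l _
    exact other_mk j l
  · intro e he
    exact mk_other (Finset.mem_filter.1 he).2
  · simp

/-- The indicator of `j` being an endpoint of `e`. -/
def inc (j : Fin N) (e : Edge N) : ℝ := if e.Has j then 1 else 0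

theorem inc_nonneg (j : Fin N) (e : Edge N) : 0 ≤ inc j e := by
  unfold inc; split_ifs <;> simp

theorem inc_le_one (j : Fin N) (e : Edge N) : inc j e ≤ 1 := by
  unfold inc; split_ifs <;> simp

theorem sum_inc_mul (j : Fin N) (F : Edge N → ℝ) :
    ∑ e, inc j e * F e = ∑ l, F (mk j l) := by
  rw [← sum_ite_has]
  simp [inc]

theorem sum_inc_le (e : Edge N) : ∑ j, inc j e ≤ 2 := by
  calc ∑ j, inc j e ≤ ∑ j, ((if e.1.1 = j then (1 : ℝ) else 0) + if e.1.2 = j then 1 else 0) := by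
        refine Finset.sum_le_sum fun j _ => ?_
        by_cases h1 : e.1.1 = j <;> by_cases h2 : e.1.2 = j <;> simp [inc, Has, h1, h2]
    _ = 2 := by rw [Finset.sum_add_distrib]; simp; norm_num

theorem sum_inc_mul_inc_le (j k : Fin N) :
    ∑ e, inc j e * inc k e ≤ 1 + N * (if j = k then 1 else 0) := by
  rw [sum_inc_mul]
  rcases eq_or_ne j k with rfl | h
  · calc ∑ l, inc j (mk j l) ≤ ∑ _l : Fin N, (1 : ℝ) :=
          Finset.sum_le_sum fun l _ => inc_le_one _ _
      _ ≤ _ := by simp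
  · simp [inc, has_mk, h]

/-- The number of common endpoints of two edges. This is the adjacency matrix of the line graph,
except on the diagonal. -/
def common (a b : Edge N) : ℝ := ∑ j, inc j a * inc j b

theorem common_nonneg (a b : Edge N) : 0 ≤ common a b :=
  Finset.sum_nonneg fun j _ => mul_nonneg (inc_nonneg j a) (inc_nonneg j b)

theorem common_le_two (a b : Edge N) : common a b ≤ 2 :=
  (Finset.sum_le_sum fun j _ => mul_le_of_le_one_right (inc_nonneg j a) (inc_le_one j b)).trans
    (sum_inc_le a)

theorem sum_common_le (a : Edge N) : ∑ b, common a b ≤ 2 * N := by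
  calc ∑ b, common a b = ∑ j, inc j a * ∑ b, inc j b * 1 := by
        simp only [common, Finset.mul_sum, mul_one]
        exact Finset.sum_comm
    _ = (∑ j, inc j a) * N := by simp only [sum_inc_mul]; simp [Finset.sum_mul]
    _ ≤ 2 * N := mul_le_mul_of_nonneg_right (sum_inc_le a) (Nat.cast_nonneg N)

theorem sum_common_sq_le (a : Edge N) : ∑ b, common a b ^ 2 ≤ 4 * N := by
  calc ∑ b, common a b ^ 2 ≤ ∑ b, 2 * common a b := Finset.sum_le_sum fun b _ => by
        nlinarith [common_nonneg a b, common_le_two a b]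
    _ ≤ 4 * N := by rw [← Finset.mul_sum]; linarith [sum_common_le a]

/-- Two edges have of order `N` common neighbours in the line graph if they have a common endpoint,
and at most four if they do not. -/
theorem sum_common_mul_common_le (a b : Edge N) :
    ∑ e, common e a * common e b ≤ 4 + N * common a b := by
  have h1 : ∑ e, common e a * common e b =
      ∑ j, ∑ k, inc j a * inc k b * ∑ e, inc j e * inc k e := by
    have h : ∀ e, common e a * common e b =
        ∑ j, ∑ k, inc j a * inc k b * (inc j e * inc k e) := by
      intro e
      rw [common, common, Finset.sum_mul_sum]
      exact Finset.sum_congr rfl fun j _ => Finset.sum_congr rfl fun k _ => by ring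
    simp_rw [h, Finset.mul_sum]
    rw [Finset.sum_comm]
    exact Finset.sum_congr rfl fun j _ => Finset.sum_comm
  rw [h1]
  calc _ ≤ ∑ j, ∑ k, inc j a * inc k b * (1 + N * (if j = k then 1 else 0)) :=
        Finset.sum_le_sum fun j _ => Finset.sum_le_sum fun k _ =>
          mul_le_mul_of_nonneg_left (sum_inc_mul_inc_le j k)
            (mul_nonneg (inc_nonneg j a) (inc_nonneg k b))
    _ = (∑ j, inc j a) * (∑ k, inc k b) + N * common a b := by
        simp only [mul_add, mul_one, Finset.sum_add_distrib, Finset.sum_mul_sum]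
        congr 1
        simp only [common, Finset.mul_sum]
        refine Finset.sum_congr rfl fun j _ => ?_
        simp
        ring
    _ ≤ _ := by
        have h2 : (∑ j, inc j a) * (∑ k, inc k b) ≤ 2 * 2 :=
          mul_le_mul (sum_inc_le a) (sum_inc_le b)
            (Finset.sum_nonneg fun k _ => inc_nonneg k b) zero_le_two
        linarith

theorem card_le (N : ℕ) : (Fintype.card (Edge N) : ℝ) ≤ (N : ℝ) ^ 2 := by
  have := Fintype.card_subtype_le fun p : Fin N × Fin N => p.1 ≤ p.2
  rw [Fintype.card_prod, Fintype.card_fin, ← sq] at this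
  exact_mod_cast this

/-- A bound for the trace of the fourth power of the matrix `common`, that is, for the weighted
number of closed walks of length four in the line graph with loops. -/
theorem sum_sum_common_sq_le (hN : 1 ≤ N) :
    ∑ a : Edge N, ∑ b : Edge N, (∑ e, common e a * common e b) ^ 2 ≤ 40 * (N : ℝ) ^ 5 := by
  have hN' : (1 : ℝ) ≤ N := by exact_mod_cast hN
  have h1 : ∀ a b : Edge N, (∑ e, common e a * common e b) ^ 2 ≤
      32 + 2 * (N : ℝ) ^ 2 * common a b ^ 2 := by
    intro a b
    have h0 : 0 ≤ ∑ e, common e a * common e b :=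
      Finset.sum_nonneg fun e _ => mul_nonneg (common_nonneg e a) (common_nonneg e b)
    have := pow_le_pow_left₀ h0 (sum_common_mul_common_le a b) 2
    nlinarith [sq_nonneg (4 - N * common a b)]
  have h2 : ∀ a : Edge N, ∑ b : Edge N, (∑ e, common e a * common e b) ^ 2 ≤ 40 * (N : ℝ) ^ 3 := by
    intro a
    calc _ ≤ ∑ b : Edge N, (32 + 2 * (N : ℝ) ^ 2 * common a b ^ 2) :=
          Finset.sum_le_sum fun b _ => h1 a b
      _ = Fintype.card (Edge N) * 32 + 2 * (N : ℝ) ^ 2 * ∑ b, common a b ^ 2 := by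
          rw [Finset.sum_add_distrib, ← Finset.mul_sum]; simp
      _ ≤ (N : ℝ) ^ 2 * 32 + 2 * (N : ℝ) ^ 2 * (4 * N) := by
          have := card_le N
          have := sum_common_sq_le a
          gcongr
      _ ≤ 40 * (N : ℝ) ^ 3 := by nlinarith [sq_nonneg (N : ℝ)]
  calc _ ≤ ∑ _a : Edge N, 40 * (N : ℝ) ^ 3 := Finset.sum_le_sum fun a _ => h2 a
    _ = Fintype.card (Edge N) * (40 * (N : ℝ) ^ 3) := by simp
    _ ≤ (N : ℝ) ^ 2 * (40 * (N : ℝ) ^ 3) := by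
        have := card_le N
        gcongr
    _ = _ := by ring

/-- The coefficient of the entry at `e` in the `j`-th coordinate of `W u`. -/
def coef (u : Fin N → ℝ) (j : Fin N) (e : Edge N) : ℝ := if e.Has j then u (e.other j) else 0

theorem sum_coef_pow_mul (u : Fin N → ℝ) (j : Fin N) {p : ℕ} (hp : p ≠ 0) (F : Edge N → ℝ) :
    ∑ e, coef u j e ^ p * F e = ∑ l, u l ^ p * F (mk j l) := by
  have h := sum_ite_has j fun e => u (e.other j) ^ p * F e
  simp only [other_mk] at h
  rw [← h]
  refine Finset.sum_congr rfl fun e _ => ?_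
  unfold coef
  split_ifs <;> simp [hp]

/-- The matrix of the quadratic form `∑ j, (W u)_j ^ 2` in the entries of `W`. -/
def gram (u : Fin N → ℝ) (a b : Edge N) : ℝ := ∑ j, coef u j a * coef u j b

theorem gram_comm (u : Fin N → ℝ) (a b : Edge N) : gram u a b = gram u b a :=
  Finset.sum_congr rfl fun _ _ => mul_comm _ _

theorem abs_gram_le {u : Fin N → ℝ} {C : ℝ} (hu : ∀ l, |u l| ≤ C) (a b : Edge N) :
    |gram u a b| ≤ C ^ 2 * common a b := by
  have h : ∀ j e, |coef u j e| ≤ C * inc j e := by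
    intro j e
    unfold coef inc
    split_ifs <;> simp [hu]
  rw [gram, common, Finset.mul_sum]
  refine (Finset.abs_sum_le_sum_abs _ _).trans (Finset.sum_le_sum fun j _ => ?_)
  rw [abs_mul]
  calc |coef u j a| * |coef u j b| ≤ (C * inc j a) * (C * inc j b) :=
        mul_le_mul (h j a) (h j b) (abs_nonneg _) ((abs_nonneg _).trans (h j a))
    _ = _ := by ring

/-- Distinct edges have at most one common endpoint, so that the square of an off-diagonal entry of
the Gram matrix has no cross terms. -/
theorem gram_sq_of_ne (u : Fin N → ℝ) {a b : Edge N} (hab : a ≠ b) :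
    gram u a b ^ 2 = ∑ j, coef u j a ^ 2 * coef u j b ^ 2 := by
  rw [gram, sq, Finset.sum_mul_sum]
  refine Finset.sum_congr rfl fun j _ => ?_
  rw [Finset.sum_eq_single j]
  · ring
  · intro k _ hkj
    by_contra hne
    have : a.Has j ∧ b.Has j ∧ a.Has k ∧ b.Has k := by
      refine ⟨?_, ?_, ?_, ?_⟩ <;>
      · by_contra hh
        exact hne (by simp [coef, hh])
    exact hab (eq_of_has hkj.symm this.1 this.2.2.1 this.2.1 this.2.2.2)
  · simp

/-- The sum of `gram u a b ^ 2 * (s a * s b)` over distinct edges `a` and `b`, rewritten as a sum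
over vertices. -/
theorem sum_gram_sq (u : Fin N → ℝ) (s : Edge N → ℝ) :
    ∑ a, ∑ b, gram u a b ^ 2 * (s a * s b) - ∑ a, gram u a a ^ 2 * (s a * s a) =
      ∑ j, (∑ l, u l ^ 2 * s (mk j l)) ^ 2 - ∑ j, ∑ l, u l ^ 4 * s (mk j l) ^ 2 := by
  have h1 : ∀ a, ∑ b, gram u a b ^ 2 * (s a * s b) - gram u a a ^ 2 * (s a * s a) =
      ∑ b, (∑ j, coef u j a ^ 2 * coef u j b ^ 2) * (s a * s b)
        - (∑ j, coef u j a ^ 2 * coef u j a ^ 2) * (s a * s a) := by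
    intro a
    rw [← Finset.sum_erase_eq_sub (Finset.mem_univ a),
      ← Finset.sum_erase_eq_sub (Finset.mem_univ a)]
    exact Finset.sum_congr rfl fun b hb => by
      rw [gram_sq_of_ne u (Finset.ne_of_mem_erase hb).symm]
  rw [← Finset.sum_sub_distrib, Finset.sum_congr rfl fun a _ => h1 a, Finset.sum_sub_distrib]
  have h2 : ∀ j, (∑ l, u l ^ 2 * s (mk j l)) ^ 2 =
      ∑ a, ∑ b, coef u j a ^ 2 * coef u j b ^ 2 * (s a * s b) := by
    intro j
    rw [← sum_coef_pow_mul u j two_ne_zero, sq, Finset.sum_mul_sum]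
    exact Finset.sum_congr rfl fun a _ => Finset.sum_congr rfl fun b _ => by ring
  have h4 : ∀ j, ∑ l, u l ^ 4 * s (mk j l) ^ 2 = ∑ a, coef u j a ^ 4 * s a ^ 2 := fun j =>
    (sum_coef_pow_mul u j four_ne_zero fun e => s e ^ 2).symm
  simp_rw [h2, h4, Finset.sum_mul]
  congr 1
  · rw [Finset.sum_comm (s := (Finset.univ : Finset (Fin N)))]
    exact Finset.sum_congr rfl fun a _ => Finset.sum_comm
  · rw [Finset.sum_comm]
    exact Finset.sum_congr rfl fun j _ => Finset.sum_congr rfl fun e _ => by ring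

end Edge

/-! ### The random matrix -/

section Wigner

variable {Ω : Type*} [MeasurableSpace Ω] {P : Measure Ω}
  {f : ℝ → ℝ → ℝ} {B : ℝ} {N : ℕ} {X : Fin N → Fin N → Ω → ℝ}

/-- The second moment of the entry at an edge. -/
noncomputable def edgeVariance (P : Measure Ω) (X : Fin N → Fin N → Ω → ℝ) (e : Edge N) : ℝ :=
  ∫ ω, X e.1.1 e.1.2 ω ^ 2 ∂P

omit [MeasurableSpace Ω] in
theorem wignerMatrix_apply_edge (X : Fin N → Fin N → Ω → ℝ) (e : Edge N) (ω : Ω) :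
    wignerMatrix X ω e.1.1 e.1.2 = X e.1.1 e.1.2 ω := by
  simp [wignerMatrix, e.2]

theorem IsWignerType.isCentredFamily (hX : IsWignerType P f B N X) (hB : 0 < B) :
    IsCentredFamily P (fun e : Edge N => X e.1.1 e.1.2) (edgeVariance P X)
      ((4 : ℝ) ^ (B * 4)) where
  indep := hX.indep
  measurable e := hX.measurable _ _ e.2
  allMoments e n := by
    have hm : AEStronglyMeasurable (X e.1.1 e.1.2) P :=
      (hX.measurable _ _ e.2).aestronglyMeasurable
    rcases Nat.eq_zero_or_pos n with rfl | hn
    · simpa using hm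
    · have h := (hX.moment e.1.1 e.1.2 n hn).1
      simp only [wignerMatrix_apply_edge] at h
      refine (integrable_norm_rpow_iff hm (by exact_mod_cast hn.ne') (by simp)).1 ?_
      simpa using h
  mean e := by simpa only [wignerMatrix_apply_edge] using hX.mean e.1.1 e.1.2
  sq e := rfl
  fourth e := by
    have h := (hX.moment e.1.1 e.1.2 4 (by norm_num)).2
    simp only [wignerMatrix_apply_edge] at h
    have h4 : ∀ ω, |X e.1.1 e.1.2 ω| ^ 4 = X e.1.1 e.1.2 ω ^ 4 := fun ω =>
      (by decide : Even 4).pow_abs _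
    simpa only [h4, Nat.cast_ofNat] using h
  one_le := Real.one_le_rpow (by norm_num) (by positivity)

theorem IsWignerType.edgeVariance_mk (hX : IsWignerType P f B N X) (j l : Fin N) :
    edgeVariance P X (Edge.mk j l) = f (gridPoint N j) (gridPoint N l) := by
  rw [← hX.variance j l]
  have hm : Measurable fun ω => wignerMatrix X ω j l := hX.measurable _ _ min_le_max
  rw [variance_of_integral_eq_zero hm.aemeasurable (hX.mean j l)]
  rfl

theorem IsWignerType.symm (hX : IsWignerType P f B N X) (j l : Fin N) :
    f (gridPoint N j) (gridPoint N l) = f (gridPoint N l) (gridPoint N j) := by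
  rw [← hX.edgeVariance_mk, Edge.mk_comm, hX.edgeVariance_mk]

omit [MeasurableSpace Ω] in
/-- `e' W² e = |W e|²` is a quadratic form in the entries of `W`, with a Gram matrix as matrix. -/
theorem quadForm_eq (X : Fin N → Fin N → Ω → ℝ) (h : ℝ → ℝ) (ω : Ω) :
    quadForm X h ω = ((N : ℝ))⁻¹ *
      quadraticForm (Edge.gram fun l => h (gridPoint N l)) Finset.univ
        (fun e : Edge N => X e.1.1 e.1.2 ω) := by
  set u : Fin N → ℝ := fun l => h (gridPoint N l) with hu
  have hsymm : (wignerMatrix X ω).transpose = wignerMatrix X ω := by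
    ext j l
    simp [wignerMatrix, min_comm, max_comm]
  have hmul : ∀ j, (wignerMatrix X ω).mulVec (signalVector N h) j =
      (√(N : ℝ))⁻¹ * ∑ e : Edge N, Edge.coef u j e * X e.1.1 e.1.2 ω := by
    intro j
    have h1 := Edge.sum_coef_pow_mul u j one_ne_zero fun e => X e.1.1 e.1.2 ω
    simp only [pow_one] at h1
    rw [h1, Matrix.mulVec, dotProduct, Finset.mul_sum]
    refine Finset.sum_congr rfl fun l _ => ?_
    simp only [signalVector, wignerMatrix, Matrix.of_apply, Edge.mk, hu]
    ring
  rw [quadForm, pow_two, ← Matrix.mulVec_mulVec, Matrix.dotProduct_mulVec,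
    ← Matrix.mulVec_transpose, hsymm, dotProduct]
  simp only [hmul]
  have hsq : ∀ x : ℝ, (√(N : ℝ))⁻¹ * x * ((√(N : ℝ))⁻¹ * x) = (N : ℝ)⁻¹ * (x * x) := by
    intro x
    rw [mul_mul_mul_comm, ← mul_inv, Real.mul_self_sqrt (Nat.cast_nonneg N)]
  simp only [hsq, ← Finset.mul_sum]
  congr 1
  have hexpand : ∀ j, (∑ e : Edge N, Edge.coef u j e * X e.1.1 e.1.2 ω) *
      (∑ e : Edge N, Edge.coef u j e * X e.1.1 e.1.2 ω) = ∑ a : Edge N, ∑ b : Edge N,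
        Edge.coef u j a * Edge.coef u j b * (X a.1.1 a.1.2 ω * X b.1.1 b.1.2 ω) := by
    intro j
    rw [Finset.sum_mul_sum]
    exact Finset.sum_congr rfl fun a _ => Finset.sum_congr rfl fun b _ => by ring
  simp_rw [hexpand, quadraticForm, Edge.gram, Finset.sum_mul]
  rw [Finset.sum_comm]
  exact Finset.sum_congr rfl fun a _ => Finset.sum_comm

/-- The variance of the off-diagonal part of the normalized quadratic form. -/
noncomputable def offDiagVariance (N : ℕ) (f : ℝ → ℝ → ℝ) (h : ℝ → ℝ) : ℝ :=
  2 * ((∑ j : Fin N, (∑ l : Fin N, h (gridPoint N l) ^ 2 * f (gridPoint N j) (gridPoint N l)) ^ 2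
    - ∑ j : Fin N, ∑ l : Fin N, h (gridPoint N l) ^ 4 * f (gridPoint N j) (gridPoint N l) ^ 2)
      / (N : ℝ) ^ 3)

theorem gridPoint_mem_Icc {N : ℕ} (j : Fin N) : gridPoint N j ∈ Set.Icc (0 : ℝ) 1 := by
  have hN : (0 : ℝ) < N := by exact_mod_cast j.pos
  have hj : ((j : ℕ) : ℝ) + 1 ≤ N := by exact_mod_cast j.2
  exact ⟨by unfold gridPoint; positivity, by rw [gridPoint, div_le_one hN]; exact hj⟩

open Complex in
/-- The quantitative central limit theorem for a random matrix of given size. -/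
theorem IsWignerType.norm_charFun_sub_le [IsProbabilityMeasure P] (hX : IsWignerType P f B N X)
    (hB : 0 < B) (hN : 1 ≤ N) {h : ℝ → ℝ} {C : ℝ} (hC : 1 ≤ C)
    (hh : ∀ x ∈ Set.Icc (0 : ℝ) 1, |h x| ≤ C) {K : ℝ} (hK : K = (4 : ℝ) ^ (B * 4)) (t : ℝ) :
    ‖∫ ω, cexp ((t * ((quadForm X h ω - ∫ ω', quadForm X h ω' ∂P) / √(N : ℝ)) : ℝ) * I) ∂P
        - Real.exp (-(offDiagVariance N f h * t ^ 2 / 2))‖ ≤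
      384 * K ^ 3 * C ^ 6 * |t| ^ 3 * (N : ℝ)⁻¹
        + (2 * |t| ^ 2 + |t|) * √(320 * K ^ 3 * C ^ 8 * (N : ℝ)⁻¹) := by
  have hF := hX.isCentredFamily hB
  rw [← hK] at hF
  have hK1 := hF.one_le
  have hN0 : (0 : ℝ) < N := by exact_mod_cast hN
  set u : Fin N → ℝ := fun l => h (gridPoint N l) with hu
  have huC : ∀ l, |u l| ≤ C := fun l => hh _ (gridPoint_mem_Icc l)
  set c : ℝ := (N : ℝ)⁻¹ * (√(N : ℝ))⁻¹ with hc
  have hc0 : 0 ≤ c := by positivity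
  have hc2 : c ^ 2 = ((N : ℝ) ^ 3)⁻¹ := by
    rw [hc, mul_pow, inv_pow, inv_pow, Real.sq_sqrt hN0.le, ← mul_inv]
    ring
  set A : Edge N → Edge N → ℝ := fun a b => c * Edge.gram u a b with hA
  have hAsymm : ∀ a b, A a b = A b a := fun a b => by simp only [hA, Edge.gram_comm u a b]
  have hAle : ∀ a b, |A a b| ≤ c * C ^ 2 * Edge.common a b := by
    intro a b
    rw [mul_assoc c, show |A a b| = c * |Edge.gram u a b| by
      simp only [hA, abs_mul c, abs_of_nonneg hc0]]
    exact mul_le_mul_of_nonneg_left (Edge.abs_gram_le huC a b) hc0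
  have hAsq : ∀ a b, A a b ^ 2 ≤ C ^ 4 * ((N : ℝ) ^ 3)⁻¹ * Edge.common a b ^ 2 := by
    intro a b
    rw [← sq_abs]
    refine (pow_le_pow_left₀ (abs_nonneg _) (hAle a b) 2).trans (le_of_eq ?_)
    rw [mul_pow, mul_pow, hc2]
    ring
  have hw : ∀ a, ∑ b, A a b ^ 2 ≤ (2 * C ^ 2 * (N : ℝ)⁻¹) ^ 2 := by
    intro a
    calc ∑ b, A a b ^ 2 ≤ ∑ b, C ^ 4 * ((N : ℝ) ^ 3)⁻¹ * Edge.common a b ^ 2 :=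
          Finset.sum_le_sum fun b _ => hAsq a b
      _ ≤ C ^ 4 * ((N : ℝ) ^ 3)⁻¹ * (4 * N) := by
          rw [← Finset.mul_sum]
          exact mul_le_mul_of_nonneg_left (Edge.sum_common_sq_le a) (by positivity)
      _ = _ := by field_simp; ring
  have hη0 : 0 < 320 * K ^ 3 * C ^ 8 * (N : ℝ)⁻¹ := by positivity
  have hη : 8 * K * (K ^ 2 * ∑ a, ∑ b, (∑ e, |A e a| * |A e b|) ^ 2) ≤
      √(320 * K ^ 3 * C ^ 8 * (N : ℝ)⁻¹) ^ 2 := by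
    rw [Real.sq_sqrt hη0.le]
    have h1 : ∀ a b, (∑ e, |A e a| * |A e b|) ^ 2 ≤
        c ^ 4 * C ^ 8 * (∑ e, Edge.common e a * Edge.common e b) ^ 2 := by
      intro a b
      have h2 : ∑ e, |A e a| * |A e b| ≤
          c ^ 2 * C ^ 4 * ∑ e, Edge.common e a * Edge.common e b := by
        rw [Finset.mul_sum]
        refine Finset.sum_le_sum fun e _ => ?_
        calc |A e a| * |A e b| ≤ (c * C ^ 2 * Edge.common e a) * (c * C ^ 2 * Edge.common e b) :=
              mul_le_mul (hAle e a) (hAle e b) (abs_nonneg _) ((abs_nonneg _).trans (hAle e a))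
          _ = _ := by ring
      refine (pow_le_pow_left₀ (Finset.sum_nonneg fun e _ => by positivity) h2 2).trans
        (le_of_eq (by ring))
    calc _ ≤ 8 * K * (K ^ 2 * (c ^ 4 * C ^ 8 * (40 * (N : ℝ) ^ 5))) := by
          refine mul_le_mul_of_nonneg_left (mul_le_mul_of_nonneg_left ?_ (by positivity))
            (by positivity)
          refine le_trans (Finset.sum_le_sum fun a _ => Finset.sum_le_sum fun b _ => h1 a b) ?_
          simp only [← Finset.mul_sum]
          exact mul_le_mul_of_nonneg_left (Edge.sum_sum_common_sq_le hN) (by positivity)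
      _ = _ := by
          rw [show c ^ 4 = (c ^ 2) ^ 2 by ring, hc2]
          field_simp
          ring
  have hd : 8 * K * ∑ a, A a a ^ 2 ≤ √(320 * K ^ 3 * C ^ 8 * (N : ℝ)⁻¹) ^ 2 := by
    rw [Real.sq_sqrt hη0.le]
    have h1 : ∀ a, A a a ^ 2 ≤ 4 * C ^ 4 * ((N : ℝ) ^ 3)⁻¹ := by
      intro a
      have h2 : Edge.common a a ^ 2 ≤ 2 ^ 2 :=
        pow_le_pow_left₀ (Edge.common_nonneg a a) (Edge.common_le_two a a) 2
      calc _ ≤ C ^ 4 * ((N : ℝ) ^ 3)⁻¹ * Edge.common a a ^ 2 := hAsq a a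
        _ ≤ C ^ 4 * ((N : ℝ) ^ 3)⁻¹ * 2 ^ 2 := mul_le_mul_of_nonneg_left h2 (by positivity)
        _ = _ := by ring
    have h3 : ∑ a, A a a ^ 2 ≤ 4 * C ^ 4 * (N : ℝ)⁻¹ := by
      calc _ ≤ ∑ _a : Edge N, 4 * C ^ 4 * ((N : ℝ) ^ 3)⁻¹ := Finset.sum_le_sum fun a _ => h1 a
        _ = Fintype.card (Edge N) * (4 * C ^ 4 * ((N : ℝ) ^ 3)⁻¹) := by simp
        _ ≤ (N : ℝ) ^ 2 * (4 * C ^ 4 * ((N : ℝ) ^ 3)⁻¹) :=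
            mul_le_mul_of_nonneg_right (Edge.card_le N) (by positivity)
        _ = _ := by field_simp
    calc _ ≤ 8 * K * (4 * C ^ 4 * (N : ℝ)⁻¹) := mul_le_mul_of_nonneg_left h3 (by positivity)
      _ = 32 * (K ^ 1 * C ^ 4 * (N : ℝ)⁻¹) := by ring
      _ ≤ 320 * (K ^ 3 * C ^ 8 * (N : ℝ)⁻¹) := by
          gcongr <;> norm_num
      _ = _ := by ring
  have hv : 2 * (∑ a, ∑ b, A a b ^ 2 * (edgeVariance P X a * edgeVariance P X b)
      - ∑ a, A a a ^ 2 * (edgeVariance P X a * edgeVariance P X a)) = offDiagVariance N f h := by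
    have h1 := Edge.sum_gram_sq u (edgeVariance P X)
    simp only [hX.edgeVariance_mk] at h1
    rw [offDiagVariance, ← h1, div_eq_mul_inv, ← hc2, sub_mul]
    simp only [Finset.sum_mul, hA]
    congr 2
    · exact Finset.sum_congr rfl fun a _ => Finset.sum_congr rfl fun b _ => by ring
    · exact Finset.sum_congr rfl fun a _ => by ring
  have hmain := hF.norm_charFun_quadraticForm_sub_diag_le hAsymm
    (by positivity : 0 < 2 * C ^ 2 * (N : ℝ)⁻¹) hw (Real.sqrt_pos.2 hη0) hη hd hv t
  have hform : ∀ ω, quadForm X h ω / √(N : ℝ) =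
      quadraticForm A Finset.univ (fun e : Edge N => X e.1.1 e.1.2 ω) := by
    intro ω
    rw [quadForm_eq]
    simp only [quadraticForm, hA, Finset.mul_sum, Finset.sum_div]
    exact Finset.sum_congr rfl fun a _ => Finset.sum_congr rfl fun b _ => by
      rw [hc]; ring
  have hmean : (∫ ω, quadForm X h ω ∂P) / √(N : ℝ) = ∑ a, A a a * edgeVariance P X a := by
    rw [← hF.integral_quadraticForm hAsymm, ← integral_div]
    exact integral_congr_ae (ae_of_all _ hform)
  simp only [sub_div, hmean, hform]
  refine hmain.trans ?_
  have h1 : (Fintype.card (Edge N) : ℝ) * (48 * t ^ 2 * K ^ 3 * (2 * C ^ 2 * (N : ℝ)⁻¹) ^ 3) ≤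
      384 * K ^ 3 * C ^ 6 * t ^ 2 * (N : ℝ)⁻¹ := by
    calc _ ≤ (N : ℝ) ^ 2 * (48 * t ^ 2 * K ^ 3 * (2 * C ^ 2 * (N : ℝ)⁻¹) ^ 3) :=
          mul_le_mul_of_nonneg_right (Edge.card_le N) (by positivity)
      _ = _ := by field_simp; ring
  have h2 := mul_le_mul_of_nonneg_right h1 (abs_nonneg t)
  have h3 : t ^ 2 * |t| = |t| ^ 3 := by rw [← sq_abs]; ring
  have h4 : 384 * K ^ 3 * C ^ 6 * t ^ 2 * (N : ℝ)⁻¹ * |t| =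
      384 * K ^ 3 * C ^ 6 * |t| ^ 3 * (N : ℝ)⁻¹ := by rw [← h3]; ring
  rw [h4] at h2
  linarith

theorem measurable_quadForm (hX : IsWignerType P f B N X) (h : ℝ → ℝ) :
    Measurable (quadForm X h) := by
  have : quadForm X h = fun ω => ((N : ℝ))⁻¹ *
      quadraticForm (Edge.gram fun l => h (gridPoint N l)) Finset.univ
        (fun e : Edge N => X e.1.1 e.1.2 ω) := funext fun ω => quadForm_eq X h ω
  rw [this]
  exact ((measurable_quadraticForm _ _).comp
    (measurable_pi_lambda _ fun e => hX.measurable _ _ e.2)).const_mul _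

end Wigner

/-- The variances converge to the limiting variance. The symmetry of `f` on the grids makes the
grid sums agree with those of the integrand. -/
theorem tendsto_offDiagVariance {f : ℝ → ℝ → ℝ} {h : ℝ → ℝ} {C C' : ℝ}
    (hf : ∀ x ∈ Set.Icc (0 : ℝ) 1, ∀ y ∈ Set.Icc (0 : ℝ) 1, |f x y| ≤ C)
    (hf_int : RiemannIntegrableOnCube 2 (fun v => f (v 0) (v 1)))
    (hf_symm : ∀ N : ℕ, 1 ≤ N → ∀ j l : Fin N,
      f (gridPoint N j) (gridPoint N l) = f (gridPoint N l) (gridPoint N j))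
    (hh : ∀ x ∈ Set.Icc (0 : ℝ) 1, |h x| ≤ C')
    (hh_int : RiemannIntegrableOnCube 1 (fun v => h (v 0))) :
    Tendsto (fun N : ℕ => offDiagVariance (N + 1) f h) atTop (𝓝 (limitVariance f h)) := by
  have h1 := tendsto_sum_varianceIntegrand hf hf_int hh hh_int
  have h2 : Tendsto (fun N : ℕ => (∑ j : Fin (N + 1), ∑ l : Fin (N + 1),
      h (gridPoint (N + 1) l) ^ 4 * f (gridPoint (N + 1) j) (gridPoint (N + 1) l) ^ 2)
        / ((N + 1 : ℕ) : ℝ) ^ 3) atTop (𝓝 0) := by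
    have h3 : Tendsto (fun N : ℕ => C' ^ 4 * C ^ 2 * (1 / ((N : ℝ) + 1))) atTop (𝓝 0) := by
      simpa using (tendsto_one_div_add_atTop_nhds_zero_nat (𝕜 := ℝ)).const_mul (C' ^ 4 * C ^ 2)
    refine squeeze_zero (fun N => by positivity) (fun N => ?_) h3
    have hb : ∀ j l : Fin (N + 1), h (gridPoint (N + 1) l) ^ 4 *
        f (gridPoint (N + 1) j) (gridPoint (N + 1) l) ^ 2 ≤ C' ^ 4 * C ^ 2 := by
      intro j l
      have e1 := pow_le_pow_left₀ (abs_nonneg _) (hh _ (gridPoint_mem_Icc l)) 4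
      have e2 := pow_le_pow_left₀ (abs_nonneg _)
        (hf _ (gridPoint_mem_Icc j) _ (gridPoint_mem_Icc l)) 2
      rw [(by decide : Even 4).pow_abs] at e1
      rw [sq_abs] at e2
      exact mul_le_mul e1 e2 (sq_nonneg _) (le_trans (by positivity) e1)
    have hs : ∑ j : Fin (N + 1), ∑ l : Fin (N + 1), h (gridPoint (N + 1) l) ^ 4 *
        f (gridPoint (N + 1) j) (gridPoint (N + 1) l) ^ 2 ≤
        ((N + 1 : ℕ) : ℝ) ^ 2 * (C' ^ 4 * C ^ 2) := by
      refine (Finset.sum_le_sum fun j _ => Finset.sum_le_sum fun l _ => hb j l).trans (le_of_eq ?_)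
      simp
      ring
    rw [div_le_iff₀ (by positivity)]
    refine hs.trans (le_of_eq ?_)
    push_cast
    field_simp
  have h4 := (h1.sub h2).const_mul 2
  rw [sub_zero] at h4
  refine h4.congr fun N => ?_
  rw [offDiagVariance, ← sub_div]
  congr 3
  rw [Finset.sum_comm]
  refine Finset.sum_congr rfl fun l _ => ?_
  rw [sq, Finset.sum_mul_sum]
  refine Finset.sum_congr rfl fun j _ => Finset.sum_congr rfl fun m _ => ?_
  rw [hf_symm (N + 1) (by omega) j l]
  ring

theorem mainTheorem4
    {Ω : ℕ → Type*} [∀ N, MeasurableSpace (Ω N)]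
    (P : (N : ℕ) → Measure (Ω N)) [∀ N, IsProbabilityMeasure (P N)]
    (f : ℝ → ℝ → ℝ)
    (hf_nonneg : ∀ x ∈ Set.Icc (0 : ℝ) 1, ∀ y ∈ Set.Icc (0 : ℝ) 1, 0 ≤ f x y)
    (hf_bdd : ∃ C : ℝ, ∀ x ∈ Set.Icc (0 : ℝ) 1, ∀ y ∈ Set.Icc (0 : ℝ) 1, f x y ≤ C)
    (hf_int : RiemannIntegrableOnCube 2 (fun v => f (v 0) (v 1)))
    (B : ℝ) (hB : 0 < B)
    (X : (N : ℕ) → Fin N → Fin N → Ω N → ℝ)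
    (hX : ∀ N : ℕ, 1 ≤ N → IsWignerType (P N) f B N (X N))
    {k : ℕ} (h : Fin k → ℝ → ℝ)
    (hh_bdd : ∀ i, ∃ C : ℝ, ∀ x ∈ Set.Icc (0 : ℝ) 1, |h i x| ≤ C)
    (hh_int : ∀ i, RiemannIntegrableOnCube 1 (fun v => h i (v 0))) :
    ∀ i : Fin k,
      TendstoInDistribution
        (fun (N : ℕ) (ω : Ω N) =>
          (quadForm (X N) (h i) ω - ∫ ω', quadForm (X N) (h i) ω' ∂(P N)) / √(N : ℝ))
        atTop
        (id : ℝ → ℝ) P (gaussianReal 0 (limitVariance f (h i)).toNNReal) := by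
  intro i
  have hmeas : ∀ N : ℕ, Measurable fun ω : Ω N =>
      (quadForm (X N) (h i) ω - ∫ ω', quadForm (X N) (h i) ω' ∂(P N)) / √(N : ℝ) := by
    intro N
    -- nothing is assumed about the entries for `N = 0`, where the quadratic form is an empty sum
    rcases Nat.eq_zero_or_pos N with rfl | hN
    · simp
    · exact ((measurable_quadForm (hX N hN) (h i)).sub_const _).div_const _
  refine ⟨fun N => (hmeas N).aemeasurable, aemeasurable_id,
    ProbabilityMeasure.tendsto_iff_tendsto_charFun.2 fun t => ?_⟩
  obtain ⟨Cf, hCf⟩ := hf_bdd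
  obtain ⟨Ch, hCh⟩ := hh_bdd i
  have hf_abs : ∀ x ∈ Set.Icc (0 : ℝ) 1, ∀ y ∈ Set.Icc (0 : ℝ) 1, |f x y| ≤ Cf :=
    fun x hx y hy => by rw [abs_of_nonneg (hf_nonneg x hx y hy)]; exact hCf x hx y hy
  -- a bound that is at least `1`, so that the higher power of it dominates the lower one
  have hh1 : ∀ x ∈ Set.Icc (0 : ℝ) 1, |h i x| ≤ max 1 Ch :=
    fun x hx => (hCh x hx).trans (le_max_right _ _)
  set v := limitVariance f (h i) with hv
  have hv0 : 0 ≤ v := limitVariance_nonneg f (h i) hf_nonneg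
  have hlimit : charFun ((gaussianReal 0 v.toNNReal).map id) t =
      ((Real.exp (-(v * t ^ 2 / 2)) : ℝ) : ℂ) := by
    rw [Measure.map_id, charFun_gaussianReal]
    have : ((v.toNNReal : ℝ) : ℂ) = v := by rw [Real.coe_toNNReal v hv0]
    push_cast
    rw [this]
    congr 1
    ring
  have hchar : ∀ N : ℕ, charFun ((P N).map fun ω : Ω N =>
      (quadForm (X N) (h i) ω - ∫ ω', quadForm (X N) (h i) ω' ∂(P N)) / √(N : ℝ)) t =
      ∫ ω, Complex.exp ((t * ((quadForm (X N) (h i) ω - ∫ ω', quadForm (X N) (h i) ω' ∂(P N))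
        / √(N : ℝ)) : ℝ) * Complex.I) ∂(P N) := by
    intro N
    rw [charFun_apply_real, integral_map (hmeas N).aemeasurable (by fun_prop)]
    simp only [Complex.ofReal_mul]
  simp only [ProbabilityMeasure.coe_mk]
  rw [hlimit]
  simp only [hchar]
  rw [← tendsto_add_atTop_iff_nat 1]
  have hvlim := tendsto_offDiagVariance hf_abs hf_int (fun N hN => (hX N hN).symm) hCh (hh_int i)
  have hexp : Tendsto (fun N : ℕ =>
      ((Real.exp (-(offDiagVariance (N + 1) f (h i) * t ^ 2 / 2)) : ℝ) : ℂ)) atTop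
      (𝓝 ((Real.exp (-(v * t ^ 2 / 2)) : ℝ) : ℂ)) :=
    (Complex.continuous_ofReal.tendsto _).comp ((Real.continuous_exp.tendsto _).comp
      (((hvlim.mul_const _).div_const _).neg))
  set K : ℝ := (4 : ℝ) ^ (B * 4) with hK
  have hinv : Tendsto (fun N : ℕ => (((N + 1 : ℕ) : ℝ))⁻¹) atTop (𝓝 0) := by
    simpa using (tendsto_one_div_add_atTop_nhds_zero_nat (𝕜 := ℝ))
  have herr : Tendsto (fun N : ℕ => 384 * K ^ 3 * max 1 Ch ^ 6 * |t| ^ 3 * (((N + 1 : ℕ) : ℝ))⁻¹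
      + (2 * |t| ^ 2 + |t|) * √(320 * K ^ 3 * max 1 Ch ^ 8 * (((N + 1 : ℕ) : ℝ))⁻¹))
      atTop (𝓝 0) := by
    have h1 := hinv.const_mul (384 * K ^ 3 * max 1 Ch ^ 6 * |t| ^ 3)
    have h2 := ((Real.continuous_sqrt.tendsto _).comp
      (hinv.const_mul (320 * K ^ 3 * max 1 Ch ^ 8))).const_mul (2 * |t| ^ 2 + |t|)
    simpa using h1.add h2
  have hdiff := squeeze_zero_norm (fun N : ℕ => (hX (N + 1) (by omega)).norm_charFun_sub_le hB
    (by omega) (le_max_left 1 Ch) hh1 hK t) herr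
  simpa using hdiff.add hexp
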